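/- Let $K$ be an algebraically closed field and let $A=\bigoplus_{i\ge 0}A_i$ be a finite-dimensional, positively graded $K$-algebra that is self-injective (i.e. injective as a right module over itself). Let $\mathrm{mod}^{\mathbb Z}A$ be the category of finitely generated $\mathbb Z$-graded right $A$-modules with degree-preserving $A$-linear maps, and let $\underline{\mathrm{mod}}^{\mathbb Z}A$ be its stable category (morphisms modulo those factoring through a projective object), a triangulated category whose shift functor $[1]$ is the graded cosyzygy $\Omega^{-1}$, with quasi-inverse $[-1]=\Omega$ the graded syzygy. For a graded module $X$ let $X(i)$ be the grade shift, $X(i)_j=X_{i+j}$, and let $X_{\le 0}=X/X_{\ge 1}$, where $X_{\ge 1}=\bigoplus_{j\ge 1}X_j$. Put $$T=\bigoplus_{i\ge 0}A(i)_{\le 0},$$ which is regarded as an object of $\underline{\mathrm{mod}}^{\mathbb Z}A$, because $A(i)_{\le 0}=A(i)$ is projective, hence zero in the stable category, for all large $i$; explicitly, $T$ is represented by $\bigoplus_{0\le i<N}A(i)_{\le 0}$ for any $N\ge 0$ such that $A_k=0$ for all $k>N$. An object $T$ of a triangulated category $\mathcal T$ is called tilting if $\mathrm{Hom}_{\mathcal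 T}(T,T[i])=0$ for all $i\ne 0$ and $\mathcal T$ is the smallest thick subcategory of $\mathcal T$ containing $T$ (thick: a full triangulated subcategory closed under isomorphisms and direct summands). Write $\mathrm{thick}\,T$ for the smallest thick subcategory of $\underline{\mathrm{mod}}^{\mathbb Z}A$ containing $T$. Then: 1. $T$ is a tilting object of $\mathrm{thick}\,T$. 2. If $A_0$ has finite global dimension, then $T$ is a tilting object of $\underline{\mathrm{mod}}^{\mathbb Z}A$. -/

import Mathlib

open CategoryTheory
open scoped TensorProduct

universe w v

noncomputable section

/-- A finitely generated `ℤ`-graded right `A`-module, for an algebra `A` over a field `K` with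
grading `𝒜`.  A right `A`-module is a module over `Aᵐᵒᵖ`; the `K`-vector space structure is the
one induced by `A` (this is `isScalarTower`). -/
structure GrMod {K : Type w} [Field K] {A : Type v} [Ring A] [Algebra K A]
    (𝒜 : ℤ → Submodule K A) where
  /-- the underlying set -/
  carrier : Type v
  [addCommGroup : AddCommGroup carrier]
  [moduleBase : Module K carrier]
  [module : Module Aᵐᵒᵖ carrier]
  [isScalarTower : IsScalarTower K Aᵐᵒᵖ carrier]
  [finite : Module.Finite Aᵐᵒᵖ carrier]
  /-- the homogeneous components -/
  deg : ℤ → Submodule K carrier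
  isInternal : DirectSum.IsInternal deg
  smul_mem : ∀ {i j : ℤ} {a : A} {x : carrier},
    a ∈ 𝒜 i → x ∈ deg j → MulOpposite.op a • x ∈ deg (j + i)

namespace GrMod

attribute [instance] addCommGroup moduleBase module isScalarTower finite

section Internal

variable {K : Type w} [Field K] {M : Type v} [AddCommGroup M] [Module K M]

theorem isInternal_of {N : Type v} [AddCommGroup N] [Module K N] (D : ℤ → Submodule K M)
    (htop : ∀ x, x ∈ ⨆ i, D i)
    (hind : ∀ i, ∀ x ∈ D i, x ≠ 0 →
      ∃ q : M →ₗ[K] N, (∀ j, j ≠ i → ∀ y ∈ D j, q y = 0) ∧ q x ≠ 0) :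
    DirectSum.IsInternal D := by
  rw [DirectSum.isInternal_submodule_iff_iSupIndep_and_iSup_eq_top]
  refine ⟨?_, eq_top_iff.2 fun x _ => htop x⟩
  rw [iSupIndep_def]
  intro i
  rw [Submodule.disjoint_def]
  intro x hx hx'
  by_contra hne
  obtain ⟨q, hq, hqx⟩ := hind i x hx hne
  have : (⨆ j, ⨆ (_ : j ≠ i), D j) ≤ LinearMap.ker q :=
    iSup₂_le fun j hj y hy => hq j hj y hy
  exact hqx (this hx')

/-- The projection of `M = ⨁ D i` onto `D i`, as an endomorphism of `M`. -/
def projOf (D : ℤ → Submodule K M) (h : DirectSum.IsInternal D) (i : ℤ) : M →ₗ[K] M :=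
  letI := h.chooseDecomposition
  (D i).subtype ∘ₗ DirectSum.component K ℤ (fun i => D i) i ∘ₗ
    (DirectSum.decomposeLinearEquiv D).toLinearMap

variable (D : ℤ → Submodule K M) (h : DirectSum.IsInternal D)

theorem projOf_mem (i : ℤ) (x : M) : projOf D h i x ∈ D i := by
  simp [projOf]

theorem projOf_same {i : ℤ} {x : M} (hx : x ∈ D i) : projOf D h i x = x := by
  let := h.chooseDecomposition
  exact DirectSum.decompose_of_mem_same D hx

theorem projOf_ne {i j : ℤ} {x : M} (hx : x ∈ D j) (hij : j ≠ i) : projOf D h i x = 0 := by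
  let := h.chooseDecomposition
  exact DirectSum.decompose_of_mem_ne D hx hij

theorem exists_sum_projOf (x : M) : ∃ s : Finset ℤ, x = ∑ i ∈ s, projOf D h i x := by
  classical
  let := h.chooseDecomposition
  exact ⟨(DirectSum.decompose D x).support, (DirectSum.sum_support_decompose D x).symm⟩

theorem exists_sum_projOf_univ [Module.Finite K M] :
    ∃ s : Finset ℤ, ∀ x, x = ∑ i ∈ s, projOf D h i x := by
  classical
  have hfin : {i | D i ≠ ⊥}.Finite :=
    WellFoundedGT.finite_ne_bot_of_iSupIndep h.submodule_iSupIndep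
  have hz : ∀ i, i ∉ hfin.toFinset → ∀ x, projOf D h i x = 0 := by
    intro i hi x
    have hb : D i = ⊥ := by simpa using hi
    have := projOf_mem D h i x
    rwa [hb, Submodule.mem_bot] at this
  refine ⟨hfin.toFinset, fun x => ?_⟩
  obtain ⟨t, ht⟩ := exists_sum_projOf D h x
  have hxt : ∀ i, i ∉ t → projOf D h i x = 0 := by
    intro i hi
    conv_lhs => rw [ht]
    rw [map_sum]
    exact Finset.sum_eq_zero fun j hj =>
      projOf_ne _ _ (projOf_mem _ _ _ _) (fun e => hi (e ▸ hj))
  calc x = ∑ i ∈ t, projOf D h i x := ht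
    _ = ∑ i ∈ t ∪ hfin.toFinset, projOf D h i x :=
      Finset.sum_subset Finset.subset_union_left fun i _ hi => hxt i hi
    _ = ∑ i ∈ hfin.toFinset, projOf D h i x :=
      (Finset.sum_subset Finset.subset_union_right fun i _ hi => hz i hi x).symm

theorem mem_of_projOf {N : Type*} [SetLike N M] [AddSubmonoidClass N M] (S : N) (x : M)
    (hx : ∀ i, projOf D h i x ∈ S) : x ∈ S := by
  obtain ⟨s, hs⟩ := exists_sum_projOf D h x
  rw [hs]
  exact sum_mem fun i _ => hx i

end Internal

variable {K : Type w} [Field K] {A : Type v} [Ring A] [Algebra K A] {𝒜 : ℤ → Submodule K A}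

/-- The projection of a graded module onto its component of degree `i`. -/
def proj (X : GrMod 𝒜) (i : ℤ) : X.carrier →ₗ[K] X.carrier := projOf X.deg X.isInternal i

/-- The homomorphisms of degree `0`: the `A`-linear maps `f` with `f(X_i) ⊆ Y_i` for all `i`. -/
def homs (X Y : GrMod 𝒜) : AddSubgroup (X.carrier →ₗ[Aᵐᵒᵖ] Y.carrier) where
  carrier := {f | ∀ i, ∀ x ∈ X.deg i, f x ∈ Y.deg i}
  zero_mem' := fun _ _ _ => zero_mem _
  add_mem' := fun hf hg i x hx => add_mem (hf i x hx) (hg i x hx)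
  neg_mem' := fun hf i x hx => neg_mem (hf i x hx)

/-- The category `mod^ℤ A` of finitely generated graded right `A`-modules. -/
instance : Category (GrMod 𝒜) where
  Hom X Y := homs X Y
  id X := ⟨LinearMap.id, fun _ _ hx => hx⟩
  comp f g := ⟨g.1 ∘ₗ f.1, fun i x hx => g.2 i _ (f.2 i x hx)⟩

/-- The `A`-linear map underlying a morphism. -/
def Hom.lin {X Y : GrMod 𝒜} (f : X ⟶ Y) : X.carrier →ₗ[Aᵐᵒᵖ] Y.carrier := Subtype.val f

/-- A degree-preserving `A`-linear map, as a morphism. -/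
def ofLin {X Y : GrMod 𝒜} (f : X.carrier →ₗ[Aᵐᵒᵖ] Y.carrier)
    (hf : ∀ i, ∀ x ∈ X.deg i, f x ∈ Y.deg i) : X ⟶ Y := Subtype.mk f hf

@[simp] theorem lin_ofLin {X Y : GrMod 𝒜} (f : X.carrier →ₗ[Aᵐᵒᵖ] Y.carrier)
    (hf : ∀ i, ∀ x ∈ X.deg i, f x ∈ Y.deg i) : Hom.lin (ofLin f hf) = f := rfl

@[simp] theorem lin_id (X : GrMod 𝒜) : Hom.lin (𝟙 X) = LinearMap.id := rfl

@[simp] theorem lin_comp {X Y Z : GrMod 𝒜} (f : X ⟶ Y) (g : Y ⟶ Z) :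
    Hom.lin (f ≫ g) = Hom.lin g ∘ₗ Hom.lin f := rfl

theorem lin_mem {X Y : GrMod 𝒜} (f : X ⟶ Y) {i : ℤ} {x : X.carrier} (hx : x ∈ X.deg i) :
    Hom.lin f x ∈ Y.deg i := f.2 i x hx

theorem hom_ext {X Y : GrMod 𝒜} {f g : X ⟶ Y} (h : ∀ x, Hom.lin f x = Hom.lin g x) : f = g :=
  Subtype.ext (LinearMap.ext h)

instance : Preadditive (GrMod 𝒜) where
  homGroup X Y := inferInstanceAs (AddCommGroup (homs X Y))
  add_comp _ _ _ f g h := hom_ext fun x => map_add (Hom.lin h) (Hom.lin f x) (Hom.lin g x)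
  comp_add _ _ _ _ _ _ := rfl

theorem lin_proj {X Y : GrMod 𝒜} (f : X ⟶ Y) (i : ℤ) (x : X.carrier) :
    Y.proj i (Hom.lin f x) = Hom.lin f (X.proj i x) := by
  obtain ⟨s, hs⟩ := exists_sum_projOf X.deg X.isInternal x
  have key : ∀ j, Y.proj i (Hom.lin f (X.proj j x))
      = Hom.lin f (X.proj i (X.proj j x)) := by
    intro j
    have hj : X.proj j x ∈ X.deg j := projOf_mem _ _ _ _
    by_cases hij : j = i
    · subst hij
      exact (projOf_same _ _ (lin_mem f hj)).trans
        (congrArg (Hom.lin f) (projOf_same _ _ hj).symm)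
    · rw [proj, projOf_ne _ _ (lin_mem f hj) hij, proj, projOf_ne _ _ hj hij, map_zero]
  conv_lhs => rw [hs]
  conv_rhs => rw [hs]
  simp only [map_sum]
  exact Finset.sum_congr rfl fun j _ => key j

/-! ### Finite direct sums, quotients, kernels, grade shift -/

/-- The direct sum `X ⊕ Y`. -/
def prod (X Y : GrMod 𝒜) : GrMod 𝒜 where
  carrier := X.carrier × Y.carrier
  deg i := (X.deg i).prod (Y.deg i)
  isInternal := by
    refine isInternal_of (N := X.carrier × Y.carrier) _ ?_ ?_
    · rintro ⟨x, y⟩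
      have hx : ((x, 0) : X.carrier × Y.carrier) ∈
          ⨆ i, (X.deg i).prod (Y.deg i) := by
        obtain ⟨s, hs⟩ := exists_sum_projOf X.deg X.isInternal x
        have : ((x, 0) : X.carrier × Y.carrier) =
            ∑ i ∈ s, LinearMap.inl K _ _ (projOf X.deg X.isInternal i x) := by
          rw [← map_sum, ← hs]; rfl
        rw [this]
        exact sum_mem fun i _ => Submodule.mem_iSup_of_mem i
          ⟨projOf_mem _ _ _ _, zero_mem _⟩
      have hy : ((0, y) : X.carrier × Y.carrier) ∈
          ⨆ i, (X.deg i).prod (Y.deg i) := by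
        obtain ⟨s, hs⟩ := exists_sum_projOf Y.deg Y.isInternal y
        have : ((0, y) : X.carrier × Y.carrier) =
            ∑ i ∈ s, LinearMap.inr K _ _ (projOf Y.deg Y.isInternal i y) := by
          rw [← map_sum, ← hs]; rfl
        rw [this]
        exact sum_mem fun i _ => Submodule.mem_iSup_of_mem i
          ⟨zero_mem _, projOf_mem _ _ _ _⟩
      simpa using add_mem hx hy
    · rintro i ⟨x, y⟩ ⟨hx, hy⟩ hne
      refine ⟨(X.proj i).prodMap (Y.proj i), ?_, ?_⟩
      · rintro j hj ⟨x', y'⟩ ⟨hx', hy'⟩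
        exact Prod.ext (projOf_ne _ _ hx' hj) (projOf_ne _ _ hy' hj)
      · intro h0
        refine hne (Eq.trans (Prod.ext ?_ ?_) h0)
        · exact (projOf_same _ _ hx).symm
        · exact (projOf_same _ _ hy).symm
  smul_mem ha hx := ⟨X.smul_mem ha hx.1, Y.smul_mem ha hx.2⟩

/-- The direct sum of a finite family of graded modules. -/
def directSum {n : ℕ} (X : Fin n → GrMod 𝒜) : GrMod 𝒜 where
  carrier := ∀ k, (X k).carrier
  deg i := Submodule.pi Set.univ fun k => (X k).deg i
  isInternal := by
    classical
    refine isInternal_of (N := ∀ k, (X k).carrier) _ ?_ ?_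
    · intro x
      have hx : ∀ k, Pi.single k (x k) ∈
          ⨆ i, Submodule.pi Set.univ fun k => (X k).deg i := by
        intro k
        obtain ⟨s, hs⟩ := exists_sum_projOf (X k).deg (X k).isInternal (x k)
        have : Pi.single k (x k) = ∑ i ∈ s, LinearMap.single K (fun k => (X k).carrier) k
            (projOf (X k).deg (X k).isInternal i (x k)) := by
          rw [← map_sum, ← hs]; rfl
        rw [this]
        refine sum_mem fun i _ => Submodule.mem_iSup_of_mem i ?_
        intro l _
        by_cases hl : l = k
        · subst hl
          simpa using projOf_mem _ _ _ _
        · simp [Pi.single_eq_of_ne hl]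
      rw [← Finset.univ_sum_single x]
      exact sum_mem fun k _ => hx k
    · intro i x hx hne
      refine ⟨LinearMap.pi fun k => (X k).proj i ∘ₗ LinearMap.proj k, ?_, ?_⟩
      · intro j hj y hy
        exact funext fun k => projOf_ne _ _ (hy k trivial) hj
      · intro h0
        exact hne ((funext fun k => (projOf_same _ _ (hx k trivial)).symm).trans h0)
  smul_mem ha hx := fun k _ => (X k).smul_mem ha (hx k trivial)

/-- The quotient of `X` by a homogeneous submodule `N`, with `(X/N)_i` the image of `X_i`. -/
def quot (X : GrMod 𝒜) (N : Submodule Aᵐᵒᵖ X.carrier) (hN : ∀ i, ∀ x ∈ N, X.proj i x ∈ N) :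
    GrMod 𝒜 where
  carrier := X.carrier ⧸ N
  deg i := (X.deg i).map (N.mkQ.restrictScalars K)
  isInternal := by
    refine isInternal_of (N := X.carrier ⧸ N) _ ?_ ?_
    · intro x
      obtain ⟨x, rfl⟩ := N.mkQ_surjective x
      rw [← Submodule.map_iSup, X.isInternal.submodule_iSup_eq_top]
      exact ⟨x, trivial, rfl⟩
    · rintro i _ ⟨x, hx, rfl⟩ hne
      let e := Submodule.Quotient.restrictScalarsEquiv K N
      let q := e.toLinearMap ∘ₗ
        (N.restrictScalars K).mapQ (N.restrictScalars K) (X.proj i) (fun y hy => hN i y hy) ∘ₗ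
          e.symm.toLinearMap
      have hq : ∀ y : X.carrier, q (N.mkQ y) = N.mkQ (X.proj i y) := fun y => rfl
      refine ⟨q, ?_, ?_⟩
      · rintro j hj _ ⟨y, hy, rfl⟩
        refine (hq y).trans ?_
        rw [proj, projOf_ne _ _ hy hj, map_zero]
      · intro h0
        refine hne (Eq.trans ?_ h0)
        refine Eq.trans ?_ (hq x).symm
        rw [proj, projOf_same _ _ hx]
        rfl
  smul_mem := by
    rintro i j a _ ha ⟨x, hx, rfl⟩
    exact ⟨_, X.smul_mem ha hx, rfl⟩

/-- The cokernel of a morphism. -/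
def coker {X Y : GrMod 𝒜} (f : X ⟶ Y) : GrMod 𝒜 :=
  quot Y (LinearMap.range (Hom.lin f)) (by
    rintro i _ ⟨x, rfl⟩
    exact ⟨X.proj i x, (lin_proj f i x).symm⟩)

/-- The canonical map `Y → coker f`. -/
def cokerπ {X Y : GrMod 𝒜} (f : X ⟶ Y) : Y ⟶ coker f :=
  ofLin (LinearMap.range (Hom.lin f)).mkQ fun _ x hx => ⟨x, hx, rfl⟩

/-- The morphism `coker f → Z` induced by `g : Y → Z` with `g ∘ f = 0`. -/
def cokerDesc {X Y Z : GrMod 𝒜} (f : X ⟶ Y) (g : Y ⟶ Z)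
    (h : ∀ x, Hom.lin g (Hom.lin f x) = 0) : coker f ⟶ Z :=
  ofLin ((LinearMap.range (Hom.lin f)).liftQ (Hom.lin g) (by
    rintro _ ⟨x, rfl⟩
    exact h x)) (by
    rintro i _ ⟨y, hy, rfl⟩
    exact lin_mem g hy)

/-- The kernel of a morphism, graded by `(ker f)_i = ker f ∩ X_i`. -/
def ker [FiniteDimensional K A] {X Y : GrMod 𝒜} (f : X ⟶ Y) : GrMod 𝒜 where
  carrier := LinearMap.ker (Hom.lin f)
  finite := by
    have : IsNoetherianRing Aᵐᵒᵖ := IsNoetherianRing.of_finite K Aᵐᵒᵖ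
    infer_instance
  deg i := (X.deg i).comap ((LinearMap.ker (Hom.lin f)).subtype.restrictScalars K)
  isInternal := by
    refine isInternal_of (N := X.carrier) _ ?_ ?_
    · intro x
      obtain ⟨s, hs⟩ := exists_sum_projOf X.deg X.isInternal x.1
      have hk : ∀ i, X.proj i x.1 ∈ LinearMap.ker (Hom.lin f) := by
        intro i
        rw [LinearMap.mem_ker, ← lin_proj, LinearMap.mem_ker.1 x.2, map_zero]
      have : x = ∑ i ∈ s, (⟨X.proj i x.1, hk i⟩ : LinearMap.ker (Hom.lin f)) := by
        apply Subtype.ext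
        rw [AddSubmonoidClass.coe_finsetSum]
        exact hs
      rw [this]
      exact sum_mem fun i _ => Submodule.mem_iSup_of_mem i (projOf_mem _ _ _ _)
    · intro i x hx hne
      refine ⟨X.proj i ∘ₗ (LinearMap.ker (Hom.lin f)).subtype.restrictScalars K, ?_, ?_⟩
      · intro j hj y hy
        exact projOf_ne _ _ hy hj
      · intro h0
        refine hne (Subtype.ext (Eq.trans ?_ h0))
        exact (projOf_same _ _ hx).symm
  smul_mem ha hx := X.smul_mem ha hx

/-- The grade shift `X(n)`: the same module, with `X(n)_j = X_{j+n}`. -/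
def gradeShift (n : ℤ) (X : GrMod 𝒜) : GrMod 𝒜 where
  carrier := X.carrier
  deg j := X.deg (j + n)
  isInternal := by
    refine isInternal_of (N := X.carrier) _ ?_ ?_
    · intro x
      have h : (⨆ j, X.deg (j + n)) = ⨆ j, X.deg j :=
        (Equiv.addRight n).iSup_congr fun _ => rfl
      rw [h, X.isInternal.submodule_iSup_eq_top]
      trivial
    · intro i x hx hne
      refine ⟨X.proj (i + n), ?_, ?_⟩
      · intro j hj y hy
        exact projOf_ne _ _ hy (by omega)
      · rwa [proj, projOf_same _ _ hx]
  smul_mem {i j a x} ha hx := by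
    have := X.smul_mem ha hx
    rwa [show j + n + i = j + i + n by ring] at this

/-- `A` as a graded right module over itself. -/
def regular (𝒜 : ℤ → Submodule K A) [GradedAlgebra 𝒜] : GrMod 𝒜 where
  carrier := A
  finite := ⟨⟨{1}, by
    rw [Finset.coe_singleton, eq_top_iff]
    intro a _
    exact Submodule.mem_span_singleton.2 ⟨MulOpposite.op a, by simp⟩⟩⟩
  deg := 𝒜
  isInternal := DirectSum.Decomposition.isInternal 𝒜
  smul_mem ha hx := SetLike.mul_mem_graded hx ha

/-! ### Truncation -/

/-- The graded submodule `X_{≥ n}` of `X`, for a positively graded algebra. -/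
def truncGE [GradedAlgebra 𝒜] (hpos : ∀ i < 0, 𝒜 i = ⊥) (n : ℤ) (X : GrMod 𝒜) :
    Submodule Aᵐᵒᵖ X.carrier where
  carrier := {x | ∀ j < n, X.proj j x = 0}
  zero_mem' := fun _ _ => map_zero _
  add_mem' := fun hx hy j hj => by rw [map_add, hx j hj, hy j hj, add_zero]
  smul_mem' := by
    intro a x hx j hj
    obtain ⟨s, hs⟩ := exists_sum_projOf X.deg X.isInternal x
    obtain ⟨t, ht⟩ := exists_sum_projOf 𝒜 (DirectSum.Decomposition.isInternal 𝒜) a.unop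
    have hat : a = ∑ l ∈ t, MulOpposite.op
        (projOf 𝒜 (DirectSum.Decomposition.isInternal 𝒜) l a.unop) := by
      rw [← Finset.op_sum, ← ht, MulOpposite.op_unop]
    rw [hs, hat, Finset.sum_smul, map_sum]
    refine Finset.sum_eq_zero fun l _ => ?_
    rw [Finset.smul_sum, map_sum]
    refine Finset.sum_eq_zero fun k _ => ?_
    have ha := projOf_mem 𝒜 (DirectSum.Decomposition.isInternal 𝒜) l a.unop
    by_cases hk : k < n
    · have : projOf X.deg X.isInternal k x = 0 := hx k hk
      rw [this, smul_zero, map_zero]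
    · by_cases hl : l < 0
      · rw [hpos l hl, Submodule.mem_bot] at ha
        rw [ha, MulOpposite.op_zero, zero_smul, map_zero]
      · exact projOf_ne _ _ (X.smul_mem ha (projOf_mem _ _ _ _)) (by omega)

/-- The graded factor module `X_{≤ n} = X / X_{≥ n+1}`. -/
def truncLE [GradedAlgebra 𝒜] (hpos : ∀ i < 0, 𝒜 i = ⊥) (n : ℤ) (X : GrMod 𝒜) : GrMod 𝒜 :=
  quot X (truncGE hpos (n + 1) X) (by
    intro i x hx j hj
    by_cases hij : i = j
    · subst hij
      rw [hx i hj, map_zero]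
    · exact projOf_ne _ _ (projOf_mem _ _ _ _) hij)

/-- The finite direct sum `⨁_{0 ≤ i < N} A(i)_{≤ 0}`. -/
def tiltingSum (𝒜 : ℤ → Submodule K A) [GradedAlgebra 𝒜] (hpos : ∀ i < 0, 𝒜 i = ⊥) (N : ℕ) :
    GrMod 𝒜 :=
  directSum fun i : Fin N => truncLE hpos 0 (gradeShift (i : ℤ) (regular 𝒜))

/-! ### The coinduced module and the cosyzygy functor -/

/-- The vector space `Hom_K(A, X)`, a right `A`-module by `(f · a)(b) = f(ab)`. -/
def Coind (X : GrMod 𝒜) : Type v := A →ₗ[K] X.carrier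

instance (X : GrMod 𝒜) : AddCommGroup (Coind X) :=
  inferInstanceAs (AddCommGroup (A →ₗ[K] X.carrier))

instance (X : GrMod 𝒜) : Module K (Coind X) :=
  inferInstanceAs (Module K (A →ₗ[K] X.carrier))

/-- An element of `Hom_K(A, X)` as a linear map. -/
def Coind.toLin {X : GrMod 𝒜} (f : Coind X) : A →ₗ[K] X.carrier := f

theorem Coind.ext {X : GrMod 𝒜} {f g : Coind X} (h : ∀ b, f.toLin b = g.toLin b) : f = g :=
  LinearMap.ext h

instance (X : GrMod 𝒜) : Module Aᵐᵒᵖ (Coind X) where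
  smul a f := f.toLin ∘ₗ LinearMap.mulLeft K a.unop
  one_smul f := Coind.ext fun b => congrArg f.toLin (one_mul b)
  mul_smul a c f := Coind.ext fun b => congrArg f.toLin (mul_assoc c.unop a.unop b)
  smul_zero _ := rfl
  smul_add _ _ _ := rfl
  add_smul a c f := Coind.ext fun b =>
    (congrArg f.toLin (add_mul a.unop c.unop b)).trans (map_add f.toLin _ _)
  zero_smul f := Coind.ext fun b => (congrArg f.toLin (zero_mul b)).trans (map_zero f.toLin)

theorem Coind.smul_toLin {X : GrMod 𝒜} (a : Aᵐᵒᵖ) (f : Coind X) (b : A) :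
    (a • f).toLin b = f.toLin (a.unop * b) := rfl

instance (X : GrMod 𝒜) : IsScalarTower K Aᵐᵒᵖ (Coind X) where
  smul_assoc k a f := Coind.ext fun b => by
    rw [Coind.smul_toLin, MulOpposite.unop_smul, smul_mul_assoc, map_smul]
    rfl

theorem finite_base [FiniteDimensional K A] (X : GrMod 𝒜) : Module.Finite K X.carrier :=
  Module.Finite.trans Aᵐᵒᵖ X.carrier

/-- The graded module `Hom_K(A, X)`, with `f` of degree `n` iff `f(A_j) ⊆ X_{n+j}` for all `j`.
It is an injective object of `mod^ℤ A`. -/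
def coind [GradedAlgebra 𝒜] [FiniteDimensional K A] (X : GrMod 𝒜) : GrMod 𝒜 where
  carrier := Coind X
  finite := by
    have := finite_base X
    have : Module.Finite K (Coind X) :=
      inferInstanceAs (Module.Finite K (A →ₗ[K] X.carrier))
    exact Module.Finite.of_restrictScalars_finite K Aᵐᵒᵖ (Coind X)
  deg n :=
    { carrier := {f | ∀ j, ∀ b ∈ 𝒜 j, f.toLin b ∈ X.deg (n + j)}
      zero_mem' := fun _ _ _ => zero_mem _
      add_mem' := fun hf hg j b hb => add_mem (hf j b hb) (hg j b hb)
      smul_mem' := fun k _ hf j b hb => Submodule.smul_mem _ k (hf j b hb) }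
  isInternal := by
    refine isInternal_of (N := X.carrier) _ ?_ ?_
    · intro f
      have hA := DirectSum.Decomposition.isInternal 𝒜
      obtain ⟨s, hs⟩ := exists_sum_projOf_univ 𝒜 hA
      have := finite_base X
      obtain ⟨t, ht⟩ := exists_sum_projOf_univ X.deg X.isInternal
      let c : ℤ → ℤ → Coind X := fun k j => X.proj k ∘ₗ f.toLin ∘ₗ projOf 𝒜 hA j
      have hf : f = ∑ k ∈ t, ∑ j ∈ s, c k j := by
        have h : f.toLin = ∑ k ∈ t, ∑ j ∈ s, X.proj k ∘ₗ f.toLin ∘ₗ projOf 𝒜 hA j := by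
          refine LinearMap.ext fun b => ?_
          simp only [LinearMap.sum_apply, LinearMap.comp_apply]
          rw [ht (f.toLin b)]
          refine Finset.sum_congr rfl fun k _ => ?_
          conv_lhs => rw [hs b]
          rw [map_sum, map_sum]
          rfl
        exact h
      rw [hf]
      refine sum_mem fun k _ => sum_mem fun j _ => Submodule.mem_iSup_of_mem (k - j) ?_
      intro l b hb
      change X.proj k (f.toLin (projOf 𝒜 hA j b)) ∈ _
      by_cases hl : l = j
      · subst hl
        rw [sub_add_cancel]
        exact projOf_mem _ _ _ _
      · rw [projOf_ne _ _ hb hl, map_zero, map_zero]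
        exact zero_mem _
    · intro n f hf hne
      have hA := DirectSum.Decomposition.isInternal 𝒜
      obtain ⟨j, b, hb, hfb⟩ : ∃ j, ∃ b ∈ 𝒜 j, f.toLin b ≠ 0 := by
        by_contra hcon
        push Not at hcon
        refine hne (Coind.ext fun b => ?_)
        obtain ⟨s, hs⟩ := exists_sum_projOf 𝒜 hA b
        rw [hs, map_sum]
        exact Finset.sum_eq_zero fun i _ => hcon i _ (projOf_mem _ _ _ _)
      refine ⟨X.proj (n + j) ∘ₗ LinearMap.applyₗ (R := K) (M := A) (M₂ := X.carrier) b, ?_, ?_⟩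
      · intro m hm g hg
        exact projOf_ne _ _ (hg j b hb) (by omega)
      · intro h0
        exact hfb ((projOf_same _ _ (hf j b hb)).symm.trans h0)
  smul_mem {i n a f} ha hf j b hb := by
    have := hf _ _ (SetLike.mul_mem_graded ha hb)
    rwa [← add_assoc] at this

/-- The embedding `X → Hom_K(A, X)`, `x ↦ (a ↦ x a)`. -/
def coindι [GradedAlgebra 𝒜] [FiniteDimensional K A] (X : GrMod 𝒜) : X ⟶ coind X :=
  ofLin (Y := coind X)
    { toFun := fun x => (
        { toFun := fun a => MulOpposite.op a • x
          map_add' := fun a b => by rw [MulOpposite.op_add, add_smul]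
          map_smul' := fun k a => by rw [MulOpposite.op_smul, smul_assoc]; rfl } :
          A →ₗ[K] X.carrier)
      map_add' := fun x y => Coind.ext fun b => smul_add (MulOpposite.op b) x y
      map_smul' := fun a x => Coind.ext fun b => by
        refine (smul_smul (MulOpposite.op b) a x).trans ?_
        rfl }
    (fun _ _ hx _ _ hb => X.smul_mem hb hx)

/-- The morphism `Hom_K(A, X) → Hom_K(A, Y)` given by composition with `f : X → Y`. -/
def coindMap [GradedAlgebra 𝒜] [FiniteDimensional K A] {X Y : GrMod 𝒜} (f : X ⟶ Y) :
    coind X ⟶ coind Y :=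
  ofLin (X := coind X) (Y := coind Y)
    { toFun := fun g => ((Hom.lin f).restrictScalars K ∘ₗ Coind.toLin g : A →ₗ[K] Y.carrier)
      map_add' := fun g _ => Coind.ext fun b => map_add (Hom.lin f) (Coind.toLin g b) _
      map_smul' := fun _ _ => rfl }
    (fun _ _ hg j b hb => lin_mem f (hg j b hb))

/-- The graded cosyzygy `Ω⁻¹ X`: the cokernel of `X → Hom_K(A, X)`. -/
def cosyzygy [GradedAlgebra 𝒜] [FiniteDimensional K A] (X : GrMod 𝒜) : GrMod 𝒜 :=
  coker (coindι X)

theorem coindMap_coindι [GradedAlgebra 𝒜] [FiniteDimensional K A] {X Y : GrMod 𝒜} (f : X ⟶ Y) :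
    coindι X ≫ coindMap f = f ≫ coindι Y :=
  hom_ext fun x => Coind.ext fun b => map_smul (Hom.lin f) (MulOpposite.op b) x

/-- The morphism `Ω⁻¹ X → Ω⁻¹ Y` induced by `f : X → Y`. -/
def cosyzygyMap [GradedAlgebra 𝒜] [FiniteDimensional K A] {X Y : GrMod 𝒜} (f : X ⟶ Y) :
    cosyzygy X ⟶ cosyzygy Y :=
  cokerDesc (coindι X) (coindMap f ≫ cokerπ (coindι Y)) (fun x => by
    have h := congrArg (fun g => Hom.lin g x) (coindMap_coindι f)
    exact (congrArg (Hom.lin (cokerπ (coindι Y))) h).trans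
      ((Submodule.Quotient.mk_eq_zero _).2 ⟨_, rfl⟩))

/-! ### The induced module and the syzygy -/

/-- The graded module `X ⊗_K A`, with `A` acting on the factor `A` (which is written on the left
here) and `(X ⊗ A)_n = ∑_j X_{n-j} ⊗ A_j`.  It is a projective object of `mod^ℤ A`. -/
def ind [GradedAlgebra 𝒜] [FiniteDimensional K A] (X : GrMod 𝒜) : GrMod 𝒜 where
  carrier := A ⊗[K] X.carrier
  finite := by
    have := finite_base X
    exact Module.Finite.of_restrictScalars_finite K Aᵐᵒᵖ (A ⊗[K] X.carrier)
  deg n := ⨆ j : ℤ, Submodule.map₂ (TensorProduct.mk K A X.carrier) (𝒜 j) (X.deg (n - j))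
  isInternal := by
    have hA := DirectSum.Decomposition.isInternal 𝒜
    obtain ⟨s, hs⟩ := exists_sum_projOf_univ 𝒜 hA
    have := finite_base X
    obtain ⟨t, ht⟩ := exists_sum_projOf_univ X.deg X.isInternal
    let p : ℤ → ℤ → A ⊗[K] X.carrier →ₗ[K] A ⊗[K] X.carrier := fun j k =>
      TensorProduct.map (projOf 𝒜 hA j) (X.proj k)
    have hsum : ∀ z, z = ∑ j ∈ s, ∑ k ∈ t, p j k z := by
      intro z
      induction z with
      | zero => simp
      | add z z' hz hz' =>
        simp only [map_add, Finset.sum_add_distrib]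
        rw [← hz, ← hz']
      | tmul a x =>
        conv_lhs => rw [hs a, ht x]
        simp only [TensorProduct.sum_tmul, TensorProduct.tmul_sum]
        rw [Finset.sum_comm]
        rfl
    refine isInternal_of (N := A ⊗[K] X.carrier) _ ?_ ?_
    · intro z
      induction z with
      | zero => exact zero_mem _
      | add z z' hz hz' => exact add_mem hz hz'
      | tmul a x =>
        rw [hs a, ht x]
        simp only [TensorProduct.sum_tmul, TensorProduct.tmul_sum]
        refine sum_mem fun k _ => sum_mem fun j _ => ?_
        refine Submodule.mem_iSup_of_mem (j + k) (Submodule.mem_iSup_of_mem j ?_)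
        refine Submodule.apply_mem_map₂ _ (projOf_mem _ _ _ _) ?_
        rw [add_sub_cancel_left]
        exact projOf_mem _ _ _ _
    · intro n z hz hne
      have hkill : ∀ j k m, m ≠ j + k →
          (⨆ l : ℤ, Submodule.map₂ (TensorProduct.mk K A X.carrier) (𝒜 l) (X.deg (m - l)))
            ≤ LinearMap.ker (p j k) := by
        intro j k m hm
        refine iSup_le fun l => Submodule.map₂_le.2 fun a ha x hx => ?_
        change projOf 𝒜 hA j a ⊗ₜ[K] X.proj k x = 0
        by_cases hl : l = j
        · have : X.proj k x = 0 := projOf_ne _ _ hx (by omega)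
          rw [this, TensorProduct.tmul_zero]
        · rw [projOf_ne _ _ ha hl, TensorProduct.zero_tmul]
      obtain ⟨j, k, hjk⟩ : ∃ j k, p j k z ≠ 0 := by
        by_contra hcon
        push Not at hcon
        refine hne ?_
        rw [hsum z]
        exact Finset.sum_eq_zero fun j _ => Finset.sum_eq_zero fun k _ => hcon j k
      have hn : n = j + k := by
        by_contra hn
        exact hjk (hkill j k n hn hz)
      exact ⟨p j k, fun m hm y hy => hkill j k m (by omega) hy, hjk⟩
  smul_mem {i n a x} ha hx := by
    let r : A ⊗[K] X.carrier →ₗ[K] A ⊗[K] X.carrier :=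
      (LinearMap.mulRight K a).rTensor X.carrier
    have hr : ∀ z, MulOpposite.op a • z = r z := by
      intro z
      induction z with
      | zero => simp
      | add z z' hz hz' => rw [smul_add, hz, hz', map_add]
      | tmul b y => rfl
    have hle : (⨆ j : ℤ, Submodule.map₂ (TensorProduct.mk K A X.carrier) (𝒜 j) (X.deg (n - j)))
        ≤ (⨆ j : ℤ, Submodule.map₂ (TensorProduct.mk K A X.carrier) (𝒜 j)
          (X.deg (n + i - j))).comap r := by
      refine iSup_le fun j => Submodule.map₂_le.2 fun b hb y hy => ?_
      refine Submodule.mem_iSup_of_mem (j + i) ?_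
      refine Submodule.apply_mem_map₂ _ (SetLike.mul_mem_graded hb ha) ?_
      rwa [add_sub_add_right_eq_sub]
    rw [hr]
    exact hle hx

/-- The `A`-linear map `X ⊗_K A → X`, `x ⊗ a ↦ x a`. -/
def indLin (X : GrMod 𝒜) : A ⊗[K] X.carrier →ₗ[Aᵐᵒᵖ] X.carrier :=
  let φ : A ⊗[K] X.carrier →ₗ[K] X.carrier := TensorProduct.lift
    (LinearMap.mk₂ K (fun (a : A) (x : X.carrier) => MulOpposite.op a • x)
      (fun a b x => by rw [MulOpposite.op_add, add_smul])
      (fun k a x => by rw [MulOpposite.op_smul, smul_assoc])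
      (fun a x y => smul_add _ x y)
      (fun k a x => by
        rw [← algebraMap_smul Aᵐᵒᵖ k x, ← algebraMap_smul Aᵐᵒᵖ k (MulOpposite.op a • x),
          smul_smul, smul_smul, Algebra.commutes]))
  { toFun := φ
    map_add' := map_add φ
    map_smul' := fun c z => by
      induction z with
      | zero => simp
      | add z z' hz hz' => rw [smul_add, map_add, map_add, hz, hz', smul_add]
      | tmul b y => exact (smul_smul c (MulOpposite.op b) y).symm }

/-- The epimorphism `X ⊗_K A → X`, `x ⊗ a ↦ x a`. -/
def indπ [GradedAlgebra 𝒜] [FiniteDimensional K A] (X : GrMod 𝒜) : ind X ⟶ X :=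
  ofLin (X := ind X) (indLin X) (by
    intro n z hz
    have hle : (⨆ j : ℤ, Submodule.map₂ (TensorProduct.mk K A X.carrier) (𝒜 j) (X.deg (n - j)))
        ≤ (X.deg n).comap ((indLin X).restrictScalars K) := by
      refine iSup_le fun j => Submodule.map₂_le.2 fun a ha x hx => ?_
      have := X.smul_mem ha hx
      rwa [sub_add_cancel] at this
    exact hle hz)

/-- The graded syzygy `Ω X`: the kernel of `X ⊗_K A → X`. -/
def syzygy [GradedAlgebra 𝒜] [FiniteDimensional K A] (X : GrMod 𝒜) : GrMod 𝒜 :=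
  ker (indπ X)

/-! ### The stable category and its triangles -/

theorem projective_prod {P Q : GrMod 𝒜} (hP : Projective P) (hQ : Projective Q) :
    Projective (prod P Q) where
  factors {E X} f e he := by
    let il : P ⟶ prod P Q := ofLin (Y := prod P Q) (LinearMap.inl Aᵐᵒᵖ P.carrier Q.carrier)
      fun _ _ hx => ⟨hx, zero_mem _⟩
    let ir : Q ⟶ prod P Q := ofLin (Y := prod P Q) (LinearMap.inr Aᵐᵒᵖ P.carrier Q.carrier)
      fun _ _ hx => ⟨zero_mem _, hx⟩
    let pl : prod P Q ⟶ P := ofLin (X := prod P Q) (LinearMap.fst Aᵐᵒᵖ P.carrier Q.carrier)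
      fun _ _ hx => hx.1
    let pr : prod P Q ⟶ Q := ofLin (X := prod P Q) (LinearMap.snd Aᵐᵒᵖ P.carrier Q.carrier)
      fun _ _ hx => hx.2
    have hsum : pl ≫ il + pr ≫ ir = 𝟙 (prod P Q) := hom_ext fun x =>
      Prod.ext (add_zero (x : P.carrier × Q.carrier).1) (zero_add (x : P.carrier × Q.carrier).2)
    refine ⟨pl ≫ Projective.factorThru (il ≫ f) e + pr ≫ Projective.factorThru (ir ≫ f) e, ?_⟩
    rw [Preadditive.add_comp, Category.assoc, Category.assoc, Projective.factorThru_comp,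
      Projective.factorThru_comp, ← Category.assoc, ← Category.assoc, ← Preadditive.add_comp,
      hsum, Category.id_comp]

variable (𝒜) in
/-- Two morphisms of `mod^ℤ A` agree in the stable category iff their difference factors through
a projective object of `mod^ℤ A`. -/
def stableRel : HomRel (GrMod 𝒜) := fun X Y f g =>
  ∃ (P : GrMod 𝒜) (_ : Projective P) (a : X ⟶ P) (b : P ⟶ Y), f - g = a ≫ b

/-- The stable relation is a congruence, so no further morphisms are identified in the quotient:
`Hom(X, Y)` in the stable category is `Hom_A(X,Y)_0` modulo the maps factoring through a
projective object. -/
instance [GradedAlgebra 𝒜] : Congruence (stableRel 𝒜) where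
  comp_left := by
    rintro X Y Z f g g' ⟨P, hP, a, b, h⟩
    exact ⟨P, hP, f ≫ a, b, by rw [← Preadditive.comp_sub, h, Category.assoc]⟩
  comp_right := by
    rintro X Y Z f f' g ⟨P, hP, a, b, h⟩
    exact ⟨P, hP, a, b ≫ g, by rw [← Preadditive.sub_comp, h, Category.assoc]⟩
  equivalence {X Y} :=
    { refl := fun f => by
        let Z : GrMod 𝒜 := coker (𝟙 (regular 𝒜))
        have hZ : ∀ z : Z.carrier, z = 0 := by
          intro z
          obtain ⟨a, rfl⟩ := Submodule.mkQ_surjective _ z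
          exact (Submodule.Quotient.mk_eq_zero _).2 ⟨a, rfl⟩
        refine ⟨Z, ⟨fun f e _ => ⟨0, hom_ext fun z => ?_⟩⟩, 0, 0, ?_⟩
        · rw [hZ z, map_zero, map_zero]
        · rw [sub_self, Limits.comp_zero]
      symm := by
        rintro f g ⟨P, hP, a, b, h⟩
        exact ⟨P, hP, -a, b, by rw [Preadditive.neg_comp, ← h, neg_sub]⟩
      trans := by
        rintro f g k ⟨P, hP, a, b, h⟩ ⟨P', hP', a', b', h'⟩
        refine ⟨prod P P', projective_prod hP hP',
          ofLin (Y := prod P P') ((Hom.lin a).prod (Hom.lin a'))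
            (fun i x hx => ⟨lin_mem a hx, lin_mem a' hx⟩),
          ofLin (X := prod P P') ((Hom.lin b).coprod (Hom.lin b'))
            (fun i x hx => add_mem (lin_mem b hx.1) (lin_mem b' hx.2)), ?_⟩
        have e : f - k = a ≫ b + a' ≫ b' := by rw [← h, ← h', sub_add_sub_cancel]
        rw [e]
        rfl }

variable (𝒜) in
/-- The stable category of `mod^ℤ A`. -/
abbrev Stable := CategoryTheory.Quotient (stableRel 𝒜)

variable (𝒜) in
/-- The projection functor from `mod^ℤ A` to the stable category. -/
abbrev toStable : GrMod 𝒜 ⥤ Stable 𝒜 := CategoryTheory.Quotient.functor (stableRel 𝒜)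

variable [GradedAlgebra 𝒜] [FiniteDimensional K A]

/-- The shift `X[n]` of the stable category: `n` times the graded cosyzygy for `n ≥ 0`, and `-n`
times the graded syzygy for `n < 0`. -/
def shift (X : Stable 𝒜) : ℤ → Stable 𝒜
  | Int.ofNat n => ⟨cosyzygy^[n] X.as⟩
  | Int.negSucc n => ⟨syzygy^[n + 1] X.as⟩

/-- The map `X → Hom_K(A, X) ⊕ Y`, `x ↦ (x, -u(x))`, whose cokernel is the pushout of
`u : X → Y` and `X → Hom_K(A, X)`. -/
def coneRel {X Y : GrMod 𝒜} (u : X ⟶ Y) : X ⟶ prod (coind X) Y :=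
  ofLin (Y := prod (coind X) Y) ((Hom.lin (coindι X)).prod (-Hom.lin u))
    (fun _ _ hx => ⟨lin_mem (coindι X) hx, neg_mem (lin_mem u hx)⟩)

/-- The cone of `u : X → Y`: the pushout of `u` along `X → Hom_K(A, X)`. -/
def cone {X Y : GrMod 𝒜} (u : X ⟶ Y) : GrMod 𝒜 := coker (coneRel u)

/-- The canonical map `Y → cone u`. -/
def coneι {X Y : GrMod 𝒜} (u : X ⟶ Y) : Y ⟶ cone u :=
  (ofLin (Y := prod (coind X) Y) (LinearMap.inr Aᵐᵒᵖ (coind X).carrier Y.carrier)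
    (fun _ _ hx => ⟨zero_mem _, hx⟩) : Y ⟶ prod (coind X) Y) ≫ cokerπ (coneRel u)

/-- The canonical map `cone u → Ω⁻¹ X`, zero on `Y` and the projection on `Hom_K(A, X)`. -/
def coneδ {X Y : GrMod 𝒜} (u : X ⟶ Y) : cone u ⟶ cosyzygy X :=
  cokerDesc (coneRel u)
    ((ofLin (X := prod (coind X) Y) (LinearMap.fst Aᵐᵒᵖ (coind X).carrier Y.carrier)
      (fun _ _ hx => hx.1) : prod (coind X) Y ⟶ coind X) ≫ cokerπ (coindι X))
    (fun x => (Submodule.Quotient.mk_eq_zero _).2 ⟨x, rfl⟩)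

/-- The distinguished triangles `X → Y → Z → X[1]` of the stable category: those isomorphic to
the image of a standard triangle `U → V → cone u → Ω⁻¹ U`. -/
def IsDistinguished {X Y Z : Stable 𝒜} (f : X ⟶ Y) (g : Y ⟶ Z) (h : Z ⟶ shift X 1) : Prop :=
  ∃ (U V : GrMod 𝒜) (u : U ⟶ V) (a : X.as ⟶ U) (b : Y ⟶ (toStable 𝒜).obj V)
    (c : Z ⟶ (toStable 𝒜).obj (cone u)),
    IsIso ((toStable 𝒜).map a) ∧ IsIso b ∧ IsIso c ∧
    f ≫ b = (toStable 𝒜).map a ≫ (toStable 𝒜).map u ∧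
    g ≫ c = b ≫ (toStable 𝒜).map (coneι u) ∧
    h ≫ (toStable 𝒜).map (cosyzygyMap a) = c ≫ (toStable 𝒜).map (coneδ u)

/-- Full subcategories are given by properties of objects.  `P` is a thick subcategory of the
full triangulated subcategory `S`: it is contained in `S` and it is, within `S`, closed under
isomorphisms, direct summands, shifts, and the third term of distinguished triangles. -/
structure IsThickIn (S P : ObjectProperty (Stable 𝒜)) : Prop where
  le : P ≤ S
  iso : ∀ {X Y : Stable 𝒜}, S Y → (X ≅ Y) → P X → P Y
  summand : ∀ {X Y : Stable 𝒜}, S X → Retract X Y → P Y → P X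
  shift : ∀ {X : Stable 𝒜} (n : ℤ), P X → P (shift X n)
  third : ∀ {X Y Z : Stable 𝒜} (f : X ⟶ Y) (g : Y ⟶ Z) (h : Z ⟶ GrMod.shift X 1),
    IsDistinguished f g h → S Z → P X → P Y → P Z
  second : ∀ {X Y Z : Stable 𝒜} (f : X ⟶ Y) (g : Y ⟶ Z) (h : Z ⟶ GrMod.shift X 1),
    IsDistinguished f g h → S Y → P X → P Z → P Y
  first : ∀ {X Y Z : Stable 𝒜} (f : X ⟶ Y) (g : Y ⟶ Z) (h : Z ⟶ GrMod.shift X 1),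
    IsDistinguished f g h → S X → P Y → P Z → P X

/-- The smallest thick subcategory of `S` that contains `T`. -/
def thickIn (S : ObjectProperty (Stable 𝒜)) (T : Stable 𝒜) : ObjectProperty (Stable 𝒜) :=
  fun X => ∀ P : ObjectProperty (Stable 𝒜), IsThickIn S P → P T → P X

/-- The smallest thick subcategory of the stable category that contains `T`. -/
abbrev thick (T : Stable 𝒜) : ObjectProperty (Stable 𝒜) := thickIn ⊤ T

theorem isThickIn_top : IsThickIn (⊤ : ObjectProperty (Stable 𝒜)) ⊤ where
  le := le_rfl
  iso _ _ _ := trivial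
  summand _ _ _ := trivial
  shift _ _ := trivial
  third _ _ _ _ _ _ _ := trivial
  second _ _ _ _ _ _ _ := trivial
  first _ _ _ _ _ _ _ := trivial

theorem isThickIn_thick (T : Stable 𝒜) : IsThickIn ⊤ (thick T) where
  le _ _ := trivial
  iso hY e hX P hP hT := hP.iso hY e (hX P hP hT)
  summand hX r hY P hP hT := hP.summand hX r (hY P hP hT)
  shift n hX P hP hT := hP.shift n (hX P hP hT)
  third f g h hd hZ hX hY P hP hT := hP.third f g h hd hZ (hX P hP hT) (hY P hP hT)
  second f g h hd hY hX hZ P hP hT := hP.second f g h hd hY (hX P hP hT) (hZ P hP hT)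
  first f g h hd hX hY hZ P hP hT := hP.first f g h hd hX (hY P hP hT) (hZ P hP hT)

/-- `T` is a tilting object of the full triangulated subcategory `S` of the stable category:
it lies in `S`, `Hom(T, T[i]) = 0` for all `i ≠ 0`, and `S` is the smallest thick subcategory of
`S` that contains `T`. -/
structure IsTiltingIn (S : ObjectProperty (Stable 𝒜)) (T : Stable 𝒜) : Prop where
  mem : S T
  hom_eq_zero : ∀ i : ℤ, i ≠ 0 → Subsingleton (T ⟶ shift T i)
  generates : thickIn S T = S

end GrMod

/-- A ring has finite global dimension: there is a common bound for the projective dimensions of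
the finitely generated right modules. -/
def HasFiniteGlobalDimension (R : Type v) [Ring R] : Prop :=
  ∃ n : ℕ, ∀ M : ModuleCat.{v} Rᵐᵒᵖ, Module.Finite Rᵐᵒᵖ M → HasProjectiveDimensionLE M n

/-- A finite dimensional graded algebra has a largest degree. -/
theorem exists_degree_bound {K : Type w} [Field K] {A : Type v} [Ring A] [Algebra K A]
    [FiniteDimensional K A] (𝒜 : ℤ → Submodule K A) [GradedAlgebra 𝒜] :
    ∃ N : ℕ, ∀ k : ℤ, (N : ℤ) < k → 𝒜 k = ⊥ := by
  have hfin : {i | 𝒜 i ≠ ⊥}.Finite := WellFoundedGT.finite_ne_bot_of_iSupIndep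
    (DirectSum.Decomposition.isInternal 𝒜).submodule_iSupIndep
  obtain ⟨b, hb⟩ := hfin.bddAbove
  refine ⟨b.toNat, fun k hk => ?_⟩
  by_contra hne
  have := hb hne
  omega

end

/-!
The proof has three parts.

*Ring theory.*  A finite-dimensional right self-injective algebra `A` is quasi-Frobenius: every
finite-dimensional right module embeds in a finite free module (`exists_injective_to_free`), hence
the injective modules `Hom_K(A, X)` are projective (`GrMod.projective_coind`), and projective and
injective graded modules coincide.  The point is that the left annihilator of every proper
two-sided ideal is nonzero (`leftAnn_ne_bot`).  Every two-sided ideal is the left annihilator of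
its right annihilator (`leftAnn_rightAnn`), so right annihilators embed the set of minimal
two-sided ideals into the finite set of maximal ones (`isCoatom_rightAnn`), while left
annihilators map a subset of the former onto the latter.  Counting shows that every maximal
two-sided ideal is a right annihilator.

*Vanishing of morphisms.*  The module `T` lies in degrees `≤ 0` and has the syzygy `⨁ A(i)_{≥ 1}`,
which lies in degrees `≥ 1`; the cosyzygies of `T` stay in degrees `≤ 0`, since `A` is positively
graded.  Thus there are no nonzero morphisms between the syzygy and the cosyzygies of `T`, in
either direction, for degree reasons, and dimension shifting (`GrMod.stablyOrthogonal_shift_iff`)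
turns this into the vanishing of the stable morphisms from `T` to its proper shifts
(`GrMod.subsingleton_hom_shift`).

*Generation.*  Short exact sequences give distinguished triangles
(`GrMod.exists_isDistinguished`), so a thick subcategory that contains `T` gives a class of graded
modules which is closed under the third term of short exact sequences and under summands
(`GrMod.IsThickClass`).  If `A₀` has finite global dimension, such a class contains all modules in
degree `d` once it contains the projective, or the injective, `A₀`-modules in degree `d`
(`GrMod.IsThickClass.of_hasProjectiveDimensionLE`, `GrMod.IsThickClass.of_injHull`).  For `d ≤ 0`
it contains the projective ones, because `A₀` is the lowest component of `A(-d)_{≤ 0}`, whose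
other components lie strictly between the degrees `d` and `1`.  For `d > 0` it contains the
injective ones `Hom_K(A₀, M)`, because these are the highest components of the projective modules
`Hom_K(A, M)`.  As every graded module is filtered by modules concentrated in one degree, the
class contains all modules.
-/

/-! ### Annihilators of two-sided ideals -/

namespace TwoSidedIdeal

variable {A : Type v} [Ring A]

/-- The left annihilator `{x | x P = 0}` of a two-sided ideal. -/
def leftAnn (P : TwoSidedIdeal A) : TwoSidedIdeal A :=
  .mk' {x | ∀ p ∈ P, x * p = 0} (fun _ _ => zero_mul _)
    (fun hx hy p hp => by rw [add_mul, hx p hp, hy p hp, add_zero])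
    (fun hx p hp => by rw [neg_mul, hx p hp, neg_zero])
    (fun hy p hp => by rw [mul_assoc, hy p hp, mul_zero])
    (fun hx p hp => by rw [mul_assoc, hx _ (P.mul_mem_left _ _ hp)])

/-- The right annihilator `{x | P x = 0}` of a two-sided ideal. -/
def rightAnn (P : TwoSidedIdeal A) : TwoSidedIdeal A :=
  .mk' {x | ∀ p ∈ P, p * x = 0} (fun _ _ => mul_zero _)
    (fun hx hy p hp => by rw [mul_add, hx p hp, hy p hp, add_zero])
    (fun hx p hp => by rw [mul_neg, hx p hp, neg_zero])
    (fun hy p hp => by rw [← mul_assoc, hy _ (P.mul_mem_right _ _ hp)])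
    (fun hx p hp => by rw [← mul_assoc, hx p hp, zero_mul])

theorem mem_leftAnn {P : TwoSidedIdeal A} {x : A} : x ∈ P.leftAnn ↔ ∀ p ∈ P, x * p = 0 :=
  mem_mk' _ _ _ _ _ _ _

theorem mem_rightAnn {P : TwoSidedIdeal A} {x : A} : x ∈ P.rightAnn ↔ ∀ p ∈ P, p * x = 0 :=
  mem_mk' _ _ _ _ _ _ _

theorem leftAnn_anti {P Q : TwoSidedIdeal A} (h : P ≤ Q) : Q.leftAnn ≤ P.leftAnn :=
  fun _ hx => mem_leftAnn.2 fun p hp => mem_leftAnn.1 hx p (h hp)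

theorem eq_bot_of_leftAnn_eq_top {P : TwoSidedIdeal A} (h : P.leftAnn = ⊤) : P = ⊥ := by
  refine eq_bot_iff.2 fun p hp => (mem_bot A).2 ?_
  have h1 : (1 : A) ∈ P.leftAnn := h ▸ mem_top A
  simpa using mem_leftAnn.1 h1 p hp

theorem asIdeal_strictMono : StrictMono (asIdeal (R := A)) := fun _ _ h => h

theorem wellFoundedLT [IsArtinianRing A] : WellFoundedLT (TwoSidedIdeal A) :=
  asIdeal_strictMono.wellFoundedLT

theorem wellFoundedGT [IsNoetherianRing A] : WellFoundedGT (TwoSidedIdeal A) :=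
  asIdeal_strictMono.wellFoundedGT

/-- A maximal two-sided ideal is prime, in the form that it contains one of finitely many
two-sided ideals as soon as it contains their intersection. -/
theorem exists_le_of_inf_le {P : TwoSidedIdeal A} (hP : IsCoatom P) {ι : Type*} (s : Finset ι)
    (Q : ι → TwoSidedIdeal A) (h : s.inf Q ≤ P) : ∃ i ∈ s, Q i ≤ P := by
  classical
  induction s using Finset.induction_on with
  | empty => exact absurd (top_le_iff.1 h) hP.1
  | insert i s _ ih =>
    rw [Finset.inf_insert] at h
    by_contra! hcon
    have h1 : ¬ Q i ≤ P := hcon i (Finset.mem_insert_self _ _)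
    have h2 : ¬ s.inf Q ≤ P := fun h' => by
      obtain ⟨j, hj, hj'⟩ := ih h'
      exact hcon j (Finset.mem_insert_of_mem hj) hj'
    have key : ∀ X : TwoSidedIdeal A, ¬ X ≤ P → ∃ p ∈ P, ∃ x ∈ X, p + x = 1 := by
      intro X hX
      have htop : P ⊔ X = ⊤ := hP.2 _ (left_lt_sup.2 hX)
      exact mem_sup.1 (htop ▸ mem_top A : (1 : A) ∈ P ⊔ X)
    obtain ⟨p, hp, x, hx, hpx⟩ := key _ h1
    obtain ⟨q, hq, y, hy, hqy⟩ := key _ h2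
    refine hP.1 ((one_mem_iff P).1 ?_)
    have hxy : x * y ∈ P := h ((mem_inf A).2 ⟨mul_mem_right _ _ _ hx, mul_mem_left _ _ _ hy⟩)
    have : (1 : A) = p * (q + y) + x * q + x * y := by
      rw [add_assoc, ← mul_add, ← add_mul, hpx, hqy, mul_one]
    rw [this]
    exact P.add_mem (P.add_mem (P.mul_mem_right _ _ hp) (P.mul_mem_left _ _ hq)) hxy

theorem finite_coatoms [IsArtinianRing A] : Finite {P : TwoSidedIdeal A // IsCoatom P} := by
  by_contra hinf
  rw [not_finite_iff_infinite] at hinf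
  let P := Infinite.natEmbedding {P : TwoSidedIdeal A // IsCoatom P}
  let f : ℕ →o (TwoSidedIdeal A)ᵒᵈ :=
    { toFun := fun n => OrderDual.toDual ((Finset.range n).inf fun i => (P i).1)
      monotone' := fun m n h => OrderDual.toDual_le_toDual.2
        (Finset.inf_mono (Finset.range_mono h)) }
  have := wellFoundedLT (A := A)
  obtain ⟨n, hn⟩ := WellFoundedGT.monotone_chain_condition f
  have h : (Finset.range n).inf (fun i => (P i).1) ≤ (P n).1 := by
    have : (Finset.range n).inf (fun i => (P i).1) =
        (Finset.range (n + 1)).inf (fun i => (P i).1) :=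
      OrderDual.toDual_inj.1 (hn (n + 1) n.le_succ)
    rw [this]
    exact Finset.inf_le (Finset.self_mem_range_succ n)
  obtain ⟨i, hi, hle⟩ := exists_le_of_inf_le (P n).2 _ _ h
  have : (P i).1 = (P n).1 :=
    ((P i).2.le_iff.1 hle).resolve_left (P n).2.1 |>.symm
  exact (Finset.mem_range.1 hi).ne (P.injective (Subtype.ext this))

end TwoSidedIdeal

/-! ### Finite-dimensional self-injective algebras -/

section SelfInjective

variable {A : Type v} [Ring A]

/-- Over a right self-injective ring, a linear map into the ring factors through any map with
smaller kernel. -/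
theorem exists_comp_eq_of_ker_le (hself : Module.Injective Aᵐᵒᵖ A) {M M' : Type v}
    [AddCommGroup M] [Module Aᵐᵒᵖ M] [AddCommGroup M'] [Module Aᵐᵒᵖ M']
    (g : M →ₗ[Aᵐᵒᵖ] M') (h : M →ₗ[Aᵐᵒᵖ] A) (hgh : LinearMap.ker g ≤ LinearMap.ker h) :
    ∃ k : M' →ₗ[Aᵐᵒᵖ] A, ∀ x, k (g x) = h x := by
  obtain ⟨k, hk⟩ := hself.out ((LinearMap.ker g).liftQ g le_rfl)
    (LinearMap.ker_eq_bot.1 (Submodule.ker_liftQ_eq_bot _ _ _ le_rfl))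
    ((LinearMap.ker g).liftQ h hgh)
  exact ⟨k, fun x => hk (Submodule.Quotient.mk x)⟩

/-- In a right self-injective algebra every two-sided ideal `X` is the left annihilator of its
right annihilator: with generators `x₁, …, xₙ` of `X` as a left ideal, an element `y` of
the double annihilator defines a map `(xᵢ a)ᵢ ↦ y a`, which extends to `Aⁿ`. -/
theorem leftAnn_rightAnn (K : Type w) [Field K] [Algebra K A] [FiniteDimensional K A]
    (hself : Module.Injective Aᵐᵒᵖ A) (X : TwoSidedIdeal A) :
    X.rightAnn.leftAnn = X := by
  have hN : IsNoetherianRing A := IsNoetherianRing.of_finite K A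
  refine le_antisymm (fun y hy => ?_) fun x hx =>
    TwoSidedIdeal.mem_leftAnn.2 fun p hp => TwoSidedIdeal.mem_rightAnn.1 hp x hx
  obtain ⟨n, x, hx⟩ := Submodule.fg_iff_exists_fin_generating_family.1
    (IsNoetherian.noetherian X.asIdeal)
  have hxX : ∀ i, x i ∈ X := fun i => TwoSidedIdeal.mem_asIdeal.1
    (hx ▸ Submodule.subset_span ⟨i, rfl⟩)
  let L : A → A →ₗ[Aᵐᵒᵖ] A := fun z =>
    { toFun := fun a => z * a
      map_add' := mul_add z
      map_smul' := fun b a => (mul_assoc z a b.unop).symm }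
  obtain ⟨k, hk⟩ := exists_comp_eq_of_ker_le hself (LinearMap.pi fun i => L (x i)) (L y) (by
    intro a ha
    refine TwoSidedIdeal.mem_leftAnn.1 hy a (TwoSidedIdeal.mem_rightAnn.2 fun p hp => ?_)
    have hle : Submodule.span A (Set.range x) ≤
        LinearMap.ker (LinearMap.toSpanSingleton A A a) := by
      rw [Submodule.span_le]
      rintro _ ⟨i, rfl⟩
      exact congrFun ha i
    exact hle (hx ▸ TwoSidedIdeal.mem_asIdeal.2 hp))
  have h1 : y = ∑ i, k (Pi.single i 1) * x i := by
    have := hk 1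
    rw [show L y 1 = y from mul_one y] at this
    rw [← this, ← Finset.univ_sum_single (LinearMap.pi (fun i => L (x i)) 1), map_sum]
    refine Finset.sum_congr rfl fun i _ => ?_
    rw [show Pi.single i (LinearMap.pi (fun i => L (x i)) 1 i)
      = MulOpposite.op (x i) • (Pi.single i 1 : Fin n → A) from ?_, map_smul]
    · rfl
    · rw [← Pi.single_smul]
      congr 1
      change x i * 1 = 1 * x i
      rw [one_mul, mul_one]
  rw [h1]
  exact sum_mem fun i _ => X.mul_mem_left _ _ (hxX i)

/-- The right annihilator of a minimal two-sided ideal `X` is a maximal two-sided ideal.  Indeed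
`X` and a simple right ideal `I ⊆ X` have the same right annihilator `P`, so `A / P` embeds in a
power of `I`; it is semisimple, and so for a proper `P' ⊇ P` the quotient `A / P'` embeds in a power
of `I` too, which makes the left annihilator of `P'` nonzero. -/
theorem isCoatom_rightAnn (K : Type w) [Field K] [Algebra K A] [FiniteDimensional K A]
    (hself : Module.Injective Aᵐᵒᵖ A) {X : TwoSidedIdeal A}
    (hX : IsAtom X) : IsCoatom X.rightAnn := by
  have hdouble := leftAnn_rightAnn K hself X
  refine ⟨fun h => hX.1 ?_, fun P' hP' => ?_⟩
  · refine eq_bot_iff.2 fun x hx => ?_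
    have : (1 : A) ∈ X.rightAnn := h ▸ TwoSidedIdeal.mem_top A
    exact (TwoSidedIdeal.mem_bot A).2 (by simpa using TwoSidedIdeal.mem_rightAnn.1 this x hx)
  by_contra hne
  have hbot : P'.leftAnn = ⊥ := by
    have hle := TwoSidedIdeal.leftAnn_anti hP'.le
    rw [hdouble] at hle
    refine (hX.le_iff.1 hle).resolve_right fun h => hP'.not_ge fun p hp => ?_
    exact TwoSidedIdeal.mem_rightAnn.2 fun x hx =>
      TwoSidedIdeal.mem_leftAnn.1 (h.symm ▸ hx) p hp
  let XR : Submodule Aᵐᵒᵖ A :=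
    { carrier := X
      zero_mem' := X.zero_mem
      add_mem' := X.add_mem
      smul_mem' := fun a x hx => X.mul_mem_right x a.unop hx }
  have hart : IsArtinian Aᵐᵒᵖ A := isArtinian_of_tower K inferInstance
  have : IsAtomic (Submodule Aᵐᵒᵖ A) := isAtomic_of_orderBot_wellFounded_lt wellFounded_lt
  obtain ⟨I, hI, hIX⟩ := (eq_bot_or_exists_atom_le XR).resolve_left fun h => hX.1 (by
    refine eq_bot_iff.2 fun x hx => (TwoSidedIdeal.mem_bot A).2 ?_
    have : x ∈ XR := hx
    rwa [h, Submodule.mem_bot] at this)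
  have hsimple : IsSimpleModule Aᵐᵒᵖ I := isSimpleModule_iff_isAtom.2 hI
  have hann : ∀ b : A, (∀ x ∈ I, x * b = 0) → b ∈ X.rightAnn := by
    let P : TwoSidedIdeal A := .mk' {b | ∀ x ∈ I, x * b = 0} (fun _ _ => mul_zero _)
      (fun hx hy p hp => by rw [mul_add, hx p hp, hy p hp, add_zero])
      (fun hx p hp => by rw [mul_neg, hx p hp, neg_zero])
      (fun {x y} hy p hp => by
        rw [← mul_assoc]
        exact hy _ (I.smul_mem (MulOpposite.op x) hp))
      (fun hx p hp => by rw [← mul_assoc, hx p hp, zero_mul])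
    have hP : ∀ b, b ∈ P ↔ ∀ x ∈ I, x * b = 0 := fun b => TwoSidedIdeal.mem_mk' _ _ _ _ _ _ _
    obtain ⟨x, hxI, hx0⟩ := I.ne_bot_iff.1 hI.1
    have hXP : X ≤ P.leftAnn := by
      refine inf_eq_left.1 ((hX.le_iff.1 inf_le_left).resolve_left fun h => hx0 ?_)
      rw [← TwoSidedIdeal.mem_bot A, ← h]
      exact (TwoSidedIdeal.mem_inf A).2 ⟨hIX hxI, TwoSidedIdeal.mem_leftAnn.2 fun p hp =>
        (hP p).1 hp x hxI⟩
    intro b hb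
    exact TwoSidedIdeal.mem_rightAnn.2 fun y hy =>
      TwoSidedIdeal.mem_leftAnn.1 (hXP hy) b ((hP b).2 hb)
  obtain ⟨n, x, hx⟩ := Submodule.fg_iff_exists_fin_generating_family.1
    (IsNoetherian.noetherian (I.restrictScalars K))
  have hxI : ∀ i, x i ∈ I := fun i => by
    have : x i ∈ I.restrictScalars K := hx ▸ Submodule.subset_span ⟨i, rfl⟩
    exact this
  let f : A →ₗ[Aᵐᵒᵖ] Fin n → I := LinearMap.pi fun i =>
    { toFun := fun a => ⟨x i * a, I.smul_mem (MulOpposite.op a) (hxI i)⟩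
      map_add' := fun a b => Subtype.ext (mul_add _ _ _)
      map_smul' := fun b a => Subtype.ext (mul_assoc (x i) a b.unop).symm }
  have hker : ∀ a, f a = 0 → a ∈ X.rightAnn := by
    intro a ha
    refine hann a fun y hy => ?_
    have hy' : y ∈ Submodule.span K (Set.range x) := by rw [hx]; exact hy
    have hle : Submodule.span K (Set.range x) ≤ LinearMap.ker (LinearMap.mulRight K a) := by
      rw [Submodule.span_le]
      rintro _ ⟨i, rfl⟩
      exact congrArg Subtype.val (congrFun ha i)
    exact hle hy'
  let P'R : Submodule Aᵐᵒᵖ A :=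
    { carrier := P'
      zero_mem' := P'.zero_mem
      add_mem' := P'.add_mem
      smul_mem' := fun a x hx => P'.mul_mem_right x a.unop hx }
  obtain ⟨C, hC⟩ := exists_isCompl (P'R.map f)
  let q := Submodule.projectionOnto C (P'R.map f) hC.symm
  have hq0 : ∀ p ∈ P', q (f p) = 0 := fun p hp =>
    (Submodule.projectionOnto_apply_eq_zero_iff hC.symm).2 ⟨p, hp, rfl⟩
  have hq1 : q (f 1) ≠ 0 := by
    intro h
    obtain ⟨p, hp, hpf⟩ := (Submodule.projectionOnto_apply_eq_zero_iff hC.symm).1 h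
    refine hne ((TwoSidedIdeal.one_mem_iff P').1 ?_)
    have h1 : f (1 - p) = 0 := by rw [map_sub, hpf, sub_self]
    have := P'.add_mem (hP'.le (hker _ h1)) hp
    rwa [sub_add_cancel] at this
  obtain ⟨i, hi⟩ : ∃ i, (q (f 1) : Fin n → I) i ≠ 0 := by
    by_contra! hcon
    exact hq1 (Subtype.ext (funext hcon))
  refine hi (Subtype.ext ((TwoSidedIdeal.mem_bot A).1 ?_))
  rw [← hbot]
  refine TwoSidedIdeal.mem_leftAnn.2 fun p hp => ?_
  have h2 : MulOpposite.op p • q (f 1) = 0 := by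
    rw [← map_smul, ← map_smul, ← hq0 p hp]
    congr 2
    exact one_mul p
  have h3 := congrFun (congrArg Subtype.val h2) i
  exact congrArg Subtype.val h3

/-- The left annihilator of a proper two-sided ideal is nonzero. -/
theorem leftAnn_ne_bot (K : Type w) [Field K] [Algebra K A] [FiniteDimensional K A]
    (hself : Module.Injective Aᵐᵒᵖ A) {P : TwoSidedIdeal A} (hP : P ≠ ⊤) : P.leftAnn ≠ ⊥ := by
  have hart : IsArtinianRing A := IsArtinianRing.of_finite K A
  have hnoe : IsNoetherianRing A := IsNoetherianRing.of_finite K A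
  have h1 := TwoSidedIdeal.wellFoundedLT (A := A)
  have h2 := TwoSidedIdeal.wellFoundedGT (A := A)
  have : IsAtomic (TwoSidedIdeal A) := isAtomic_of_orderBot_wellFounded_lt wellFounded_lt
  have : IsCoatomic (TwoSidedIdeal A) := isCoatomic_of_orderTop_gt_wellFounded wellFounded_gt
  have hfin := TwoSidedIdeal.finite_coatoms (A := A)
  have hex : ∀ Q : {Q : TwoSidedIdeal A // IsCoatom Q},
      ∃ X : TwoSidedIdeal A, IsAtom X ∧ X.leftAnn = Q.1 := by
    intro Q
    have hQ := leftAnn_rightAnn K hself Q.1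
    obtain ⟨X, hX, hXQ⟩ := (eq_bot_or_exists_atom_le Q.1.rightAnn).resolve_left fun h =>
      Q.2.1 (by
        rw [← hQ, h]
        exact eq_top_iff.2 fun x _ => TwoSidedIdeal.mem_leftAnn.2 fun p hp => by
          rw [(TwoSidedIdeal.mem_bot A).1 hp, mul_zero])
    have hle := TwoSidedIdeal.leftAnn_anti hXQ
    rw [hQ] at hle
    exact ⟨X, hX, (Q.2.le_iff.1 hle).resolve_left fun h =>
      hX.1 (TwoSidedIdeal.eq_bot_of_leftAnn_eq_top h)⟩
  choose X hX hXQ using hex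
  let φ : {Q : TwoSidedIdeal A // IsCoatom Q} → {Q : TwoSidedIdeal A // IsCoatom Q} :=
    fun Q => ⟨(X Q).rightAnn, isCoatom_rightAnn K hself (hX Q)⟩
  have hφ : ∀ Q, (φ Q).1.leftAnn = X Q := fun Q => leftAnn_rightAnn K hself (X Q)
  -- An injective self-map of the finite set of maximal two-sided ideals is surjective.
  have hinj : Function.Injective φ := by
    intro Q Q' h
    apply Subtype.ext
    rw [← hXQ, ← hXQ, ← hφ, ← hφ, h]
  obtain ⟨P', hP', hle⟩ := (eq_top_or_exists_le_coatom P).resolve_left hP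
  obtain ⟨Q, hQ⟩ := Finite.injective_iff_surjective.1 hinj ⟨P', hP'⟩
  intro h
  refine (hX Q).1 ?_
  rw [← hφ, hQ, ← le_bot_iff, ← h]
  exact TwoSidedIdeal.leftAnn_anti hle

variable {M : Type v} [AddCommGroup M] [Module Aᵐᵒᵖ M]

/-- Every nonzero finite-dimensional right module has a nonzero map to `A`: an element `y ≠ 0` that
is annihilated by the annihilator `P` of `M` gives a map from `A / P`, which is contained in a power
of `M`. -/
theorem exists_linearMap_ne_zero (K : Type w) [Field K] [Algebra K A] [FiniteDimensional K A]
    [Module K M] [IsScalarTower K Aᵐᵒᵖ M] [Module.Finite K M]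
    (hself : Module.Injective Aᵐᵒᵖ A) [Nontrivial M] :
    ∃ f : M →ₗ[Aᵐᵒᵖ] A, f ≠ 0 := by
  let P : TwoSidedIdeal A := .mk' {b | ∀ x : M, MulOpposite.op b • x = 0}
      (fun x => by rw [MulOpposite.op_zero, zero_smul])
      (fun hx hy p => by rw [MulOpposite.op_add, add_smul, hx p, hy p, add_zero])
      (fun hx p => by rw [MulOpposite.op_neg, neg_smul, hx p, neg_zero])
      (fun hy p => by rw [MulOpposite.op_mul, mul_smul, hy])
      (fun hx p => by rw [MulOpposite.op_mul, mul_smul, hx, smul_zero])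
  have hP : ∀ b, b ∈ P ↔ ∀ x : M, MulOpposite.op b • x = 0 :=
    fun b => TwoSidedIdeal.mem_mk' _ _ _ _ _ _ _
  have hne : P ≠ ⊤ := by
    intro h
    obtain ⟨x, hx⟩ := exists_ne (0 : M)
    have := (hP 1).1 (h ▸ TwoSidedIdeal.mem_top A) x
    rw [MulOpposite.op_one, one_smul] at this
    exact hx this
  obtain ⟨y, hy, hy0⟩ : ∃ y ∈ P.leftAnn, y ≠ 0 := by
    by_contra! hcon
    exact leftAnn_ne_bot K hself hne (eq_bot_iff.2 fun y hy =>
      (TwoSidedIdeal.mem_bot A).2 (hcon y hy))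
  obtain ⟨n, s, hs⟩ :=
    Submodule.fg_iff_exists_fin_generating_family.1 (Module.Finite.fg_top (R := K) (M := M))
  let g : A →ₗ[Aᵐᵒᵖ] Fin n → M := LinearMap.pi fun i =>
    { toFun := fun a => MulOpposite.op a • s i
      map_add' := fun a b => by rw [MulOpposite.op_add, add_smul]
      map_smul' := fun b a => mul_smul b (MulOpposite.op a) (s i) }
  let h : A →ₗ[Aᵐᵒᵖ] A :=
    { toFun := fun a => y * a
      map_add' := mul_add y
      map_smul' := fun b a => (mul_assoc y a b.unop).symm }
  obtain ⟨k, hk⟩ := exists_comp_eq_of_ker_le hself g h (by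
    intro a ha
    refine TwoSidedIdeal.mem_leftAnn.1 hy a ((hP a).2 fun x => ?_)
    have hx : x ∈ Submodule.span K (Set.range s) := hs ▸ Submodule.mem_top
    induction hx using Submodule.span_induction with
    | mem p h =>
      obtain ⟨i, rfl⟩ := h
      exact congrFun ha i
    | zero => exact smul_zero _
    | add p q _ _ ihp ihq => rw [smul_add, ihp, ihq, add_zero]
    | smul c p _ ihp =>
      rw [← algebraMap_smul Aᵐᵒᵖ c p, smul_smul, ← Algebra.commutes, ← smul_smul, ihp, smul_zero])
  by_contra! hcon
  refine hy0 ?_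
  have h1 : k = 0 := LinearMap.pi_ext' fun i => by
    rw [hcon (k ∘ₗ LinearMap.single Aᵐᵒᵖ (fun _ => M) i), LinearMap.zero_comp]
  have h2 := hk 1
  rw [h1] at h2
  exact (mul_one y).symm.trans h2.symm

/-- Every finite-dimensional right module embeds in a finite free module. -/
theorem exists_injective_to_free (K : Type w) [Field K] [Algebra K A] [FiniteDimensional K A]
    [Module K M] [IsScalarTower K Aᵐᵒᵖ M] [Module.Finite K M]
    (hself : Module.Injective Aᵐᵒᵖ A) :
    ∃ (n : ℕ) (f : M →ₗ[Aᵐᵒᵖ] Fin n → A), Function.Injective f := by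
  have hart : IsArtinian Aᵐᵒᵖ M := isArtinian_of_tower K inferInstance
  -- Among the kernels of maps to finite free modules take a minimal one.
  obtain ⟨N, ⟨n, f, rfl⟩, hmin⟩ := WellFounded.has_min (wellFounded_lt (α := Submodule Aᵐᵒᵖ M))
    {N | ∃ (n : ℕ) (f : M →ₗ[Aᵐᵒᵖ] Fin n → A), LinearMap.ker f = N} ⟨_, 0, 0, rfl⟩
  refine ⟨n, f, LinearMap.ker_eq_bot.1 ?_⟩
  by_contra hne
  have : Nontrivial (LinearMap.ker f) := (Submodule.nontrivial_iff_ne_bot).2 hne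
  have : Module.Finite K (LinearMap.ker f) :=
    inferInstanceAs (Module.Finite K ((LinearMap.ker f).restrictScalars K))
  obtain ⟨g, hg⟩ := exists_linearMap_ne_zero (M := LinearMap.ker f) K hself
  obtain ⟨h, hh⟩ := hself.out (LinearMap.ker f).subtype Subtype.val_injective g
  refine hmin _ ⟨n + 1, LinearMap.pi (Fin.cons h fun i => LinearMap.proj i ∘ₗ f), rfl⟩ ?_
  have hmem : ∀ x, x ∈ LinearMap.ker (LinearMap.pi (φ := fun _ : Fin (n + 1) => A)
      (Fin.cons h fun i => LinearMap.proj i ∘ₗ f)) ↔ h x = 0 ∧ f x = 0 := by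
    intro x
    rw [LinearMap.mem_ker, funext_iff, Fin.forall_fin_succ, funext_iff]
    rfl
  refine lt_of_le_of_ne (fun x hx => ((hmem x).1 hx).2) fun heq => hg ?_
  ext x
  rw [← hh x]
  exact ((hmem _).1 (heq.ge x.2)).1

end SelfInjective

/-- A ring is free as a right module over itself. -/
theorem module_free_mulOpposite (A : Type v) [Ring A] : Module.Free Aᵐᵒᵖ A :=
  let e : Aᵐᵒᵖ ≃ₗ[Aᵐᵒᵖ] A :=
    { MulOpposite.opAddEquiv.symm with map_smul' := fun _ _ => rfl }
  Module.Free.of_equiv e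

namespace GrMod

variable {K : Type w} [Field K] {A : Type v} [Ring A] [Algebra K A] {𝒜 : ℤ → Submodule K A}

/-! ### Homogeneous elements -/

theorem proj_mem (X : GrMod 𝒜) (i : ℤ) (x : X.carrier) : X.proj i x ∈ X.deg i :=
  projOf_mem _ _ _ _

theorem proj_same (X : GrMod 𝒜) {i : ℤ} {x : X.carrier} (hx : x ∈ X.deg i) : X.proj i x = x :=
  projOf_same _ _ hx

theorem proj_ne (X : GrMod 𝒜) {i j : ℤ} {x : X.carrier} (hx : x ∈ X.deg j) (hij : j ≠ i) :
    X.proj i x = 0 :=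
  projOf_ne _ _ hx hij

theorem deg_induction (X : GrMod 𝒜) {p : X.carrier → Prop} (h0 : p 0)
    (hadd : ∀ x y, p x → p y → p (x + y)) (hdeg : ∀ i, ∀ x ∈ X.deg i, p x) (x : X.carrier) :
    p x := by
  obtain ⟨s, hs⟩ := exists_sum_projOf X.deg X.isInternal x
  rw [hs]
  exact Finset.sum_induction _ p hadd h0 fun i _ => hdeg i _ (projOf_mem _ _ _ _)

theorem eq_zero_of_proj (X : GrMod 𝒜) {x : X.carrier} (h : ∀ i, X.proj i x = 0) : x = 0 := by
  obtain ⟨s, hs⟩ := exists_sum_projOf X.deg X.isInternal x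
  rw [hs]
  exact Finset.sum_eq_zero fun i _ => h i

theorem hom_ext_deg {X Y : GrMod 𝒜} {f g : X ⟶ Y}
    (h : ∀ i, ∀ x ∈ X.deg i, Hom.lin f x = Hom.lin g x) : f = g :=
  hom_ext fun x => X.deg_induction (p := fun x => Hom.lin f x = Hom.lin g x)
    (by rw [map_zero, map_zero]) (fun x y hx hy => by rw [map_add, map_add, hx, hy]) h x

theorem algebra_deg_induction [GradedAlgebra 𝒜] {p : A → Prop} (h0 : p 0)
    (hadd : ∀ x y, p x → p y → p (x + y)) (hdeg : ∀ i, ∀ x ∈ 𝒜 i, p x) (x : A) : p x :=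
  (regular 𝒜).deg_induction h0 hadd hdeg x

theorem proj_smul (X : GrMod 𝒜) {i : ℤ} {a : A} (ha : a ∈ 𝒜 i) (k : ℤ) (x : X.carrier) :
    X.proj (k + i) (MulOpposite.op a • x) = MulOpposite.op a • X.proj k x := by
  refine X.deg_induction (p := fun x => X.proj (k + i) (MulOpposite.op a • x)
    = MulOpposite.op a • X.proj k x) ?_ ?_ ?_ x
  · simp only [smul_zero, map_zero]
  · intro x y hx hy
    rw [smul_add, map_add, hx, hy, map_add, smul_add]
  · intro j x hx
    by_cases hj : j = k
    · subst hj
      rw [X.proj_same hx, X.proj_same (X.smul_mem ha hx)]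
    · rw [X.proj_ne hx hj, smul_zero, X.proj_ne (X.smul_mem ha hx) (by omega)]

/-! ### The component of degree zero of a linear map -/

/-- The degree `0` component of an `A`-linear map between graded modules is a morphism. -/
theorem exists_hom_of_linearMap [GradedAlgebra 𝒜] [FiniteDimensional K A] {X Y : GrMod 𝒜}
    (g : X.carrier →ₗ[Aᵐᵒᵖ] Y.carrier) :
    ∃ f : X ⟶ Y, ∀ i, ∀ x ∈ X.deg i, Hom.lin f x = Y.proj i (g x) := by
  have := finite_base X
  obtain ⟨s, hs⟩ := exists_sum_projOf_univ X.deg X.isInternal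
  let g₀ : X.carrier →+ Y.carrier :=
    ∑ i ∈ s, ((Y.proj i).toAddMonoidHom.comp g.toAddMonoidHom).comp (X.proj i).toAddMonoidHom
  have hg₀ : ∀ i, ∀ x ∈ X.deg i, g₀ x = Y.proj i (g x) := by
    intro i x hx
    have h1 : g₀ x = ∑ j ∈ s, Y.proj j (g (X.proj j x)) := by
      simp only [g₀, AddMonoidHom.finsetSum_apply]
      rfl
    rw [h1]
    by_cases hi : i ∈ s
    · rw [Finset.sum_eq_single_of_mem i hi, X.proj_same hx]
      intro j _ hj
      rw [X.proj_ne hx hj.symm, map_zero, map_zero]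
    · have hne : ∀ j ∈ s, i ≠ j := fun j hj e => hi (e ▸ hj)
      have hx0 : x = 0 := by
        rw [hs x]
        exact Finset.sum_eq_zero fun j hj => X.proj_ne hx (hne j hj)
      rw [hx0]
      simp only [map_zero, Finset.sum_const_zero]
  refine ⟨ofLin { g₀ with map_smul' := ?_ } fun i x hx => ?_, hg₀⟩
  · intro a x
    change g₀ (a • x) = a • g₀ x
    refine X.deg_induction (p := fun x => g₀ (a • x) = a • g₀ x) ?_ ?_ ?_ x
    · rw [smul_zero, map_zero, smul_zero]
    · intro x y hx hy
      rw [smul_add, map_add, hx, hy, map_add, smul_add]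
    · intro k x hx
      refine algebra_deg_induction (𝒜 := 𝒜) (p := fun b : A => g₀ (MulOpposite.op b • x)
        = MulOpposite.op b • g₀ x) ?_ ?_ ?_ a.unop
      · rw [MulOpposite.op_zero, zero_smul, zero_smul, map_zero]
      · intro b c hb hc
        rw [MulOpposite.op_add, add_smul, add_smul, map_add, hb, hc]
      · intro i b hb
        rw [hg₀ _ _ (X.smul_mem hb hx), map_smul, Y.proj_smul hb, hg₀ _ _ hx]
  · exact (hg₀ i x hx).symm ▸ Y.proj_mem i _

/-! ### Epimorphisms, short exact sequences -/

theorem surjective_of_epi {X Y : GrMod 𝒜} (e : X ⟶ Y) [Epi e] :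
    Function.Surjective (Hom.lin e) := by
  have h : cokerπ e = 0 := by
    rw [← cancel_epi e, Limits.comp_zero]
    exact hom_ext fun x => (Submodule.Quotient.mk_eq_zero _).2 ⟨x, rfl⟩
  intro y
  have hy : Hom.lin (cokerπ e) y = 0 := by
    rw [h]
    rfl
  exact (Submodule.Quotient.mk_eq_zero _).1 hy

theorem epi_of_surjective {X Y : GrMod 𝒜} (e : X ⟶ Y) (he : Function.Surjective (Hom.lin e)) :
    Epi e where
  left_cancellation g h hgh := hom_ext fun y => by
    obtain ⟨x, rfl⟩ := he y
    exact congrArg (fun k => Hom.lin k x) hgh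

theorem projective_of_module [GradedAlgebra 𝒜] [FiniteDimensional K A] (P : GrMod 𝒜)
    [Module.Projective Aᵐᵒᵖ P.carrier] : Projective P where
  factors {E X} f e he := by
    obtain ⟨h, hh⟩ := Module.projective_lifting_property (Hom.lin e) (Hom.lin f)
      (surjective_of_epi e)
    obtain ⟨k, hk⟩ := exists_hom_of_linearMap (X := P) (Y := E) h
    refine ⟨k, hom_ext_deg fun i x hx => ?_⟩
    rw [lin_comp, LinearMap.comp_apply, hk i x hx, ← lin_proj, ← LinearMap.comp_apply, hh,
      lin_proj, P.proj_same hx]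

/-- Over a graded algebra, a graded module that is injective as a module is injective as a graded
module. -/
theorem exists_extension_of_module_injective [GradedAlgebra 𝒜] [FiniteDimensional K A]
    {P X Y : GrMod 𝒜} (hP : Module.Injective Aᵐᵒᵖ P.carrier) (i : X ⟶ Y)
    (hi : Function.Injective (Hom.lin i)) (f : X ⟶ P) : ∃ g : Y ⟶ P, i ≫ g = f := by
  obtain ⟨h, hh⟩ := hP.out (Hom.lin i) hi (Hom.lin f)
  obtain ⟨k, hk⟩ := exists_hom_of_linearMap (X := Y) (Y := P) h
  refine ⟨k, hom_ext_deg fun j x hx => ?_⟩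
  rw [lin_comp, LinearMap.comp_apply, hk j _ (lin_mem i hx), hh, P.proj_same (lin_mem f hx)]

/-- `0 → X → Y → Z → 0` is a short exact sequence of graded modules. -/
structure IsShortExact {X Y Z : GrMod 𝒜} (f : X ⟶ Y) (g : Y ⟶ Z) : Prop where
  injective : Function.Injective (Hom.lin f)
  surjective : Function.Surjective (Hom.lin g)
  exact : ∀ y, Hom.lin g y = 0 ↔ ∃ x, Hom.lin f x = y

namespace IsShortExact

variable {X Y Z : GrMod 𝒜} {f : X ⟶ Y} {g : Y ⟶ Z} (h : IsShortExact f g)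

include h

theorem comp_eq_zero : f ≫ g = 0 := hom_ext fun x => (h.exact _).2 ⟨x, rfl⟩

theorem exists_desc {W : GrMod 𝒜} (k : Y ⟶ W) (hk : f ≫ k = 0) : ∃ l : Z ⟶ W, g ≫ l = k := by
  have hker : LinearMap.ker (Hom.lin g) ≤ LinearMap.ker (Hom.lin k) := by
    intro y hy
    obtain ⟨x, rfl⟩ := (h.exact y).1 hy
    exact congrArg (fun m => Hom.lin m x) hk
  let l : Z.carrier →ₗ[Aᵐᵒᵖ] W.carrier := (LinearMap.ker (Hom.lin g)).liftQ (Hom.lin k) hker ∘ₗ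
    ((Hom.lin g).quotKerEquivOfSurjective h.surjective).symm.toLinearMap
  have hl : ∀ y, l (Hom.lin g y) = Hom.lin k y := by
    intro y
    have : ((Hom.lin g).quotKerEquivOfSurjective h.surjective).symm (Hom.lin g y)
        = Submodule.Quotient.mk y := by
      rw [LinearEquiv.symm_apply_eq]
      rfl
    change (LinearMap.ker (Hom.lin g)).liftQ (Hom.lin k) hker _ = _
    rw [LinearEquiv.coe_coe, this]
    rfl
  refine ⟨ofLin l fun i z hz => ?_, hom_ext hl⟩
  obtain ⟨y, rfl⟩ := h.surjective z
  rw [← Z.proj_same hz, lin_proj, hl]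
  exact lin_mem k (Y.proj_mem i y)

theorem exists_lift {W : GrMod 𝒜} (k : W ⟶ Y) (hk : k ≫ g = 0) : ∃ l : W ⟶ X, l ≫ f = k := by
  have hr : ∀ w, Hom.lin k w ∈ LinearMap.range (Hom.lin f) := fun w =>
    (h.exact _).1 (congrArg (fun m => Hom.lin m w) hk)
  let l : W.carrier →ₗ[Aᵐᵒᵖ] X.carrier := (LinearEquiv.ofInjective (Hom.lin f) h.injective).symm ∘ₗ
    (Hom.lin k).codRestrict _ hr
  have hl : ∀ w, Hom.lin f (l w) = Hom.lin k w := fun w =>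
    congrArg Subtype.val ((LinearEquiv.ofInjective (Hom.lin f) h.injective).apply_symm_apply
      ⟨Hom.lin k w, hr w⟩)
  refine ⟨ofLin l fun i w hw => ?_, hom_ext hl⟩
  have : X.proj i (l w) = l w := h.injective (by
    rw [← lin_proj, hl, Y.proj_same (lin_mem k hw)])
  exact this ▸ X.proj_mem i _

theorem epi : Epi g := epi_of_surjective g h.surjective

theorem mono : Mono f where
  right_cancellation _ _ hkl := hom_ext fun x =>
    h.injective (congrArg (fun m => Hom.lin m x) hkl)

end IsShortExact

/-- The embedding of the kernel. -/
def kerι [FiniteDimensional K A] {X Y : GrMod 𝒜} (f : X ⟶ Y) : ker f ⟶ X :=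
  ofLin (X := ker f) (LinearMap.ker (Hom.lin f)).subtype fun _ _ hx => hx

theorem isShortExact_ker [FiniteDimensional K A] {X Y : GrMod 𝒜} (f : X ⟶ Y)
    (hf : Function.Surjective (Hom.lin f)) : IsShortExact (kerι f) f where
  injective := Subtype.val_injective
  surjective := hf
  exact y := ⟨fun hy => ⟨⟨y, hy⟩, rfl⟩, by rintro ⟨x, rfl⟩; exact x.2⟩

theorem isShortExact_coker {X Y : GrMod 𝒜} (f : X ⟶ Y)
    (hf : Function.Injective (Hom.lin f)) : IsShortExact f (cokerπ f) where
  injective := hf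
  surjective := Submodule.mkQ_surjective _
  exact _ := Submodule.Quotient.mk_eq_zero _

section Lifting

variable {X' P X Y Q Z : GrMod 𝒜} {i : X' ⟶ P} {p : P ⟶ X} {j : Y ⟶ Q} {q : Q ⟶ Z}

/-- Dimension shifting: for short exact sequences `0 → X' → P → X → 0` and `0 → Y → Q → Z → 0`, if
every map `X' → Y` extends to `P`, then a map `X → Z` lifts to `Q` as soon as its restriction to `P`
does. -/
theorem exists_lift_of_extends (h : IsShortExact i p) (h' : IsShortExact j q) (f : X ⟶ Z)
    (g : P ⟶ Q) (hg : g ≫ q = p ≫ f) (hext : ∀ k : X' ⟶ Y, ∃ l : P ⟶ Y, i ≫ l = k) :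
    ∃ l : X ⟶ Q, l ≫ q = f := by
  obtain ⟨k, hk⟩ := h'.exists_lift (i ≫ g) (by
    rw [Category.assoc, hg, ← Category.assoc, h.comp_eq_zero, Limits.zero_comp])
  obtain ⟨l, hl⟩ := hext k
  obtain ⟨m, hm⟩ := h.exists_desc (g - l ≫ j) (by
    rw [Preadditive.comp_sub, ← Category.assoc, hl, hk, sub_self])
  refine ⟨m, ?_⟩
  have := h.epi
  rw [← cancel_epi p, ← Category.assoc, hm, Preadditive.sub_comp, Category.assoc, h'.comp_eq_zero,
    Limits.comp_zero, sub_zero, hg]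

/-- The converse dimension shift: if every map `X → Z` lifts to `Q`, then a map `X' → Y` extends to
`P` as soon as its composite with `Y → Q` does. -/
theorem exists_extension_of_lifts (h : IsShortExact i p) (h' : IsShortExact j q) (f : X' ⟶ Y)
    (g : P ⟶ Q) (hg : i ≫ g = f ≫ j) (hlift : ∀ k : X ⟶ Z, ∃ l : X ⟶ Q, l ≫ q = k) :
    ∃ l : P ⟶ Y, i ≫ l = f := by
  obtain ⟨k, hk⟩ := h.exists_desc (g ≫ q) (by
    rw [← Category.assoc, hg, Category.assoc, h'.comp_eq_zero, Limits.comp_zero])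
  obtain ⟨l, hl⟩ := hlift k
  obtain ⟨m, hm⟩ := h'.exists_lift (g - p ≫ l) (by
    rw [Preadditive.sub_comp, Category.assoc, hl, hk, sub_self])
  refine ⟨m, ?_⟩
  have := h'.mono
  rw [← cancel_mono j, Category.assoc, hm, Preadditive.comp_sub, ← Category.assoc, h.comp_eq_zero,
    Limits.zero_comp, sub_zero, hg]

end Lifting

/-! ### Projective graded modules over a self-injective algebra -/

section SelfInjective

variable [GradedAlgebra 𝒜] [FiniteDimensional K A]

theorem coindι_injective (X : GrMod 𝒜) : Function.Injective (Hom.lin (coindι X)) := by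
  intro x y hxy
  have h : (1 : Aᵐᵒᵖ) • x = (1 : Aᵐᵒᵖ) • y := congrArg (fun f => Coind.toLin f 1) hxy
  rwa [one_smul, one_smul] at h

theorem indπ_surjective (X : GrMod 𝒜) : Function.Surjective (Hom.lin (indπ X)) := fun x =>
  ⟨(1 : A) ⊗ₜ[K] x, one_smul Aᵐᵒᵖ x⟩

/-- The module `Hom_K(A, X)` is projective: it embeds in a finite free module, and the embedding
splits because a `K`-linear map to `X` is the same as an `A`-linear map to `Hom_K(A, X)`. -/
theorem module_projective_coind (hself : Module.Injective Aᵐᵒᵖ A) (X : GrMod 𝒜) :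
    Module.Projective Aᵐᵒᵖ (coind X).carrier := by
  have := finite_base (coind X)
  have := module_free_mulOpposite A
  obtain ⟨n, f, hf⟩ := exists_injective_to_free (M := (coind X).carrier) K hself
  obtain ⟨ρ, hρ⟩ := (f.restrictScalars K).exists_leftInverse_of_injective
    (LinearMap.ker_eq_bot.2 hf)
  have hρ' : ∀ x, ρ (f x) = x := fun x => LinearMap.congr_fun hρ x
  let r : (Fin n → A) →ₗ[Aᵐᵒᵖ] Coind X :=
    { toFun := fun v =>
        ({ toFun := fun b => Coind.toLin (ρ (MulOpposite.op b • v)) 1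
           map_add' := fun b c => by rw [MulOpposite.op_add, add_smul, map_add]; rfl
           map_smul' := fun k b => by rw [MulOpposite.op_smul, smul_assoc, map_smul]; rfl } :
          A →ₗ[K] X.carrier)
      map_add' := fun v v' => Coind.ext fun b =>
        (congrArg (fun z => Coind.toLin (ρ z) 1) (smul_add (MulOpposite.op b) v v')).trans
          (congrArg (fun z => Coind.toLin z 1) (map_add ρ _ _))
      map_smul' := fun a v => Coind.ext fun b =>
        congrArg (fun z => Coind.toLin (ρ z) 1) (smul_smul (MulOpposite.op b) a v) }
  refine Module.Projective.of_split f r (LinearMap.ext fun g => Coind.ext fun b => ?_)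
  change Coind.toLin (ρ (MulOpposite.op b • f g)) 1 = Coind.toLin g b
  rw [← map_smul, hρ']
  exact congrArg (Coind.toLin g) (mul_one b)

theorem projective_coind (hself : Module.Injective Aᵐᵒᵖ A) (X : GrMod 𝒜) :
    Projective (coind X) :=
  have := module_projective_coind hself X
  projective_of_module _

theorem module_projective_ind (X : GrMod 𝒜) : Module.Projective Aᵐᵒᵖ (ind X).carrier :=
  have := module_free_mulOpposite A
  inferInstanceAs (Module.Projective Aᵐᵒᵖ (A ⊗[K] X.carrier))

theorem projective_ind (X : GrMod 𝒜) : Projective (ind X) :=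
  have := module_projective_ind X
  projective_of_module _

theorem projective_regular_gradeShift (n : ℤ) : Projective (gradeShift n (regular 𝒜)) :=
  have : Module.Projective Aᵐᵒᵖ (gradeShift n (regular 𝒜)).carrier :=
    have := module_free_mulOpposite A
    inferInstanceAs (Module.Projective Aᵐᵒᵖ A)
  projective_of_module _

theorem module_injective_of_projective (hself : Module.Injective Aᵐᵒᵖ A) (P : GrMod 𝒜)
    [Projective P] : Module.Injective Aᵐᵒᵖ P.carrier := by
  have := epi_of_surjective _ (indπ_surjective P)
  let s := Projective.factorThru (𝟙 P) (indπ P)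
  have hs : ∀ x, Hom.lin (indπ P) (Hom.lin s x) = x := fun x =>
    congrArg (fun f => Hom.lin f x) (Projective.factorThru_comp (𝟙 P) (indπ P))
  have := module_projective_ind P
  have := Module.Projective.of_split (Hom.lin s) (Hom.lin (indπ P)) (LinearMap.ext hs)
  obtain ⟨n, g, hg⟩ := Submodule.fg_iff_exists_fin_generating_family.1
    (Module.Finite.fg_top (R := Aᵐᵒᵖ) (M := P.carrier))
  let π : (Fin n → A) →ₗ[Aᵐᵒᵖ] P.carrier :=
    { toFun := fun v => ∑ i, MulOpposite.op (v i) • g i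
      map_add' := fun v v' => by
        rw [← Finset.sum_add_distrib]
        exact Finset.sum_congr rfl fun i _ => add_smul _ _ _
      map_smul' := fun a v => by
        rw [RingHom.id_apply, Finset.smul_sum]
        exact Finset.sum_congr rfl fun i _ => mul_smul _ _ _ }
  have hπ : Function.Surjective π := by
    intro x
    obtain ⟨c, rfl⟩ := (Submodule.mem_span_range_iff_exists_fun Aᵐᵒᵖ).1
      (hg ▸ Submodule.mem_top : x ∈ Submodule.span Aᵐᵒᵖ (Set.range g))
    exact ⟨fun i => (c i).unop, rfl⟩
  obtain ⟨t, ht⟩ := Module.projective_lifting_property π LinearMap.id hπ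
  refine ⟨fun X Y _ _ _ _ f hf k => ?_⟩
  choose l hl using fun i => hself.out f hf (LinearMap.proj i ∘ₗ t ∘ₗ k)
  refine ⟨π ∘ₗ LinearMap.pi l, fun x => ?_⟩
  have : LinearMap.pi l (f x) = t (k x) := funext fun i => hl i x
  rw [LinearMap.comp_apply, this]
  exact LinearMap.congr_fun ht (k x)

/-- Projective graded modules over a self-injective algebra are injective. -/
theorem exists_extension_of_projective (hself : Module.Injective Aᵐᵒᵖ A) {P X Y : GrMod 𝒜}
    (hP : Projective P) (i : X ⟶ Y) (hi : Function.Injective (Hom.lin i)) (f : X ⟶ P) :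
    ∃ g : Y ⟶ P, i ≫ g = f :=
  exists_extension_of_module_injective (module_injective_of_projective hself P) i hi f

end SelfInjective

end GrMod

namespace GrMod

variable {K : Type w} [Field K] {A : Type v} [Ring A] [Algebra K A] {𝒜 : ℤ → Submodule K A}

/-! ### Modules concentrated in a range of degrees -/

/-- The graded module `X` vanishes in all degrees greater than `d`. -/
def SuppLE (X : GrMod 𝒜) (d : ℤ) : Prop := ∀ j, d < j → X.deg j = ⊥

/-- The graded module `X` vanishes in all degrees less than `d`. -/
def SuppGE (X : GrMod 𝒜) (d : ℤ) : Prop := ∀ j, j < d → X.deg j = ⊥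

theorem deg_eq_bot_of_surjective {X Y : GrMod 𝒜} (f : X ⟶ Y)
    (hf : Function.Surjective (Hom.lin f)) {j : ℤ} (h : X.deg j = ⊥) : Y.deg j = ⊥ := by
  refine eq_bot_iff.2 fun y hy => ?_
  obtain ⟨x, rfl⟩ := hf y
  have hx : X.proj j x = 0 := by
    have := X.proj_mem j x
    rwa [h, Submodule.mem_bot] at this
  rw [Submodule.mem_bot, ← Y.proj_same hy, lin_proj, hx, map_zero]

theorem deg_eq_bot_of_injective {X Y : GrMod 𝒜} (f : X ⟶ Y)
    (hf : Function.Injective (Hom.lin f)) {j : ℤ} (h : Y.deg j = ⊥) : X.deg j = ⊥ := by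
  refine eq_bot_iff.2 fun x hx => ?_
  have := lin_mem f hx
  rw [h, Submodule.mem_bot] at this
  exact (Submodule.mem_bot K).2 (hf (this.trans (map_zero _).symm))

theorem SuppLE.of_surjective {X Y : GrMod 𝒜} {d : ℤ} (h : X.SuppLE d) (f : X ⟶ Y)
    (hf : Function.Surjective (Hom.lin f)) : Y.SuppLE d :=
  fun j hj => deg_eq_bot_of_surjective f hf (h j hj)

theorem SuppLE.of_injective {X Y : GrMod 𝒜} {d : ℤ} (h : Y.SuppLE d) (f : X ⟶ Y)
    (hf : Function.Injective (Hom.lin f)) : X.SuppLE d :=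
  fun j hj => deg_eq_bot_of_injective f hf (h j hj)

theorem SuppGE.of_surjective {X Y : GrMod 𝒜} {d : ℤ} (h : X.SuppGE d) (f : X ⟶ Y)
    (hf : Function.Surjective (Hom.lin f)) : Y.SuppGE d :=
  fun j hj => deg_eq_bot_of_surjective f hf (h j hj)

theorem SuppGE.of_injective {X Y : GrMod 𝒜} {d : ℤ} (h : Y.SuppGE d) (f : X ⟶ Y)
    (hf : Function.Injective (Hom.lin f)) : X.SuppGE d :=
  fun j hj => deg_eq_bot_of_injective f hf (h j hj)

theorem SuppLE.mono {X : GrMod 𝒜} {a b : ℤ} (h : X.SuppLE a) (hab : a ≤ b) : X.SuppLE b :=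
  fun j hj => h j (hab.trans_lt hj)

theorem eq_zero_of_supp {X Y : GrMod 𝒜} {a b : ℤ} (hX : X.SuppGE a) (hY : Y.SuppLE b)
    (hab : b < a) (f : X ⟶ Y) : f = 0 := by
  refine hom_ext_deg fun i x hx => ?_
  rcases lt_or_ge i a with hi | hi
  · rw [hX i hi, Submodule.mem_bot] at hx
    rw [hx, map_zero, map_zero]
  · have := lin_mem f hx
    rw [hY i (hab.trans_le hi), Submodule.mem_bot] at this
    exact this

theorem eq_zero_of_supp' {X Y : GrMod 𝒜} {a b : ℤ} (hX : X.SuppLE a) (hY : Y.SuppGE b)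
    (hab : a < b) (f : X ⟶ Y) : f = 0 := by
  refine hom_ext_deg fun i x hx => ?_
  rcases lt_or_ge a i with hi | hi
  · rw [hX i hi, Submodule.mem_bot] at hx
    rw [hx, map_zero, map_zero]
  · have := lin_mem f hx
    rw [hY i (hi.trans_lt hab), Submodule.mem_bot] at this
    exact this

theorem exists_suppLE [FiniteDimensional K A] (X : GrMod 𝒜) : ∃ d : ℕ, X.SuppLE d := by
  have := finite_base X
  have hfin : {i | X.deg i ≠ ⊥}.Finite :=
    WellFoundedGT.finite_ne_bot_of_iSupIndep X.isInternal.submodule_iSupIndep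
  obtain ⟨b, hb⟩ := hfin.bddAbove
  refine ⟨b.toNat, fun j hj => ?_⟩
  by_contra hne
  have := hb hne
  omega

theorem exists_suppGE [FiniteDimensional K A] (X : GrMod 𝒜) : ∃ d : ℕ, X.SuppGE (-d) := by
  have := finite_base X
  have hfin : {i | X.deg i ≠ ⊥}.Finite :=
    WellFoundedGT.finite_ne_bot_of_iSupIndep X.isInternal.submodule_iSupIndep
  obtain ⟨b, hb⟩ := hfin.bddBelow
  refine ⟨(-b).toNat, fun j hj => ?_⟩
  by_contra hne
  have := hb hne
  omega

theorem suppGE_ker_of_forall [FiniteDimensional K A] {X Y : GrMod 𝒜} (f : X ⟶ Y) (n : ℤ)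
    (h : ∀ j < n, ∀ x ∈ X.deg j, Hom.lin f x = 0 → x = 0) : (ker f).SuppGE n := by
  intro j hj
  refine eq_bot_iff.2 fun x hx => (Submodule.mem_bot K).2 (Subtype.ext ?_)
  exact h j hj _ hx x.2

section Truncation

variable [GradedAlgebra 𝒜] (hpos : ∀ i < 0, 𝒜 i = ⊥)

/-- The projection `X → X_{≤ n}`. -/
def truncLEπ (n : ℤ) (X : GrMod 𝒜) : X ⟶ truncLE hpos n X :=
  ofLin (Y := truncLE hpos n X) (truncGE hpos (n + 1) X).mkQ fun _ x hx => ⟨x, hx, rfl⟩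

theorem truncLEπ_surjective (n : ℤ) (X : GrMod 𝒜) :
    Function.Surjective (Hom.lin (truncLEπ hpos n X)) :=
  Submodule.mkQ_surjective _

theorem truncLEπ_eq_zero {n : ℤ} {X : GrMod 𝒜} {x : X.carrier} :
    Hom.lin (truncLEπ hpos n X) x = 0 ↔ ∀ j < n + 1, X.proj j x = 0 :=
  Submodule.Quotient.mk_eq_zero _

theorem truncLEπ_eq_zero_of_mem {n j : ℤ} {X : GrMod 𝒜} {x : X.carrier} (hx : x ∈ X.deg j) :
    Hom.lin (truncLEπ hpos n X) x = 0 ↔ x = 0 ∨ n < j := by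
  rw [truncLEπ_eq_zero]
  constructor
  · intro h
    rw [or_iff_not_imp_right]
    intro hj
    rw [← X.proj_same hx]
    exact h j (by omega)
  · rintro (rfl | h) i hi
    · exact map_zero _
    · exact X.proj_ne hx (by omega)

theorem suppLE_truncLE (n : ℤ) (X : GrMod 𝒜) : (truncLE hpos n X).SuppLE n := by
  intro j hj
  refine eq_bot_iff.2 ?_
  rintro _ ⟨x, hx, rfl⟩
  exact (Submodule.mem_bot K).2 ((truncLEπ_eq_zero_of_mem hpos hx).2 (Or.inr hj))

theorem exists_desc_truncLE {n : ℤ} {X Y : GrMod 𝒜} (hY : Y.SuppLE n) (f : X ⟶ Y) :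
    ∃ g : truncLE hpos n X ⟶ Y, truncLEπ hpos n X ≫ g = f := by
  have hle : truncGE hpos (n + 1) X ≤ LinearMap.ker (Hom.lin f) := by
    intro x hx
    refine Y.eq_zero_of_proj fun i => ?_
    rcases lt_or_ge n i with hi | hi
    · have := Y.proj_mem i (Hom.lin f x)
      rwa [hY i hi, Submodule.mem_bot] at this
    · rw [lin_proj, hx i (by omega), map_zero]
  exact ⟨ofLin (X := truncLE hpos n X) ((truncGE hpos (n + 1) X).liftQ (Hom.lin f) hle) (by
    rintro i _ ⟨x, hx, rfl⟩
    exact lin_mem f hx), rfl⟩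

variable [FiniteDimensional K A]

/-- The graded submodule `X_{> n}` of `X`, as the kernel of `X → X_{≤ n}`. -/
abbrev truncGT (n : ℤ) (X : GrMod 𝒜) : GrMod 𝒜 := ker (truncLEπ hpos n X)

theorem isShortExact_trunc (n : ℤ) (X : GrMod 𝒜) :
    IsShortExact (kerι (truncLEπ hpos n X)) (truncLEπ hpos n X) :=
  isShortExact_ker _ (truncLEπ_surjective hpos n X)

theorem suppGE_truncGT (n : ℤ) (X : GrMod 𝒜) : (truncGT hpos n X).SuppGE (n + 1) :=
  suppGE_ker_of_forall _ _ fun _ hj _ hx h =>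
    ((truncLEπ_eq_zero_of_mem hpos hx).1 h).resolve_right (by omega)

include hpos in
theorem SuppLE.coind {X : GrMod 𝒜} {d : ℤ} (h : X.SuppLE d) : (coind X).SuppLE d := by
  intro n hn
  refine eq_bot_iff.2 fun f hf => (Submodule.mem_bot K).2 (Coind.ext fun b => ?_)
  refine algebra_deg_induction (𝒜 := 𝒜) (p := fun b => Coind.toLin f b = 0) (map_zero _)
    (fun x y hx hy => by rw [map_add, hx, hy, add_zero]) (fun j b hb => ?_) b
  rcases lt_or_ge j 0 with hj | hj
  · rw [hpos j hj, Submodule.mem_bot] at hb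
    rw [hb, map_zero]
  · have := hf j b hb
    rwa [h _ (by omega), Submodule.mem_bot] at this

theorem isShortExact_cosyzygy (X : GrMod 𝒜) : IsShortExact (coindι X) (cokerπ (coindι X)) :=
  isShortExact_coker _ (coindι_injective X)

theorem isShortExact_syzygy (X : GrMod 𝒜) : IsShortExact (kerι (indπ X)) (indπ X) :=
  isShortExact_ker _ (indπ_surjective X)

include hpos in
theorem SuppLE.cosyzygy {X : GrMod 𝒜} {d : ℤ} (h : X.SuppLE d) : (cosyzygy X).SuppLE d :=
  (h.coind hpos).of_surjective _ (isShortExact_cosyzygy X).surjective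

include hpos in
theorem SuppLE.cosyzygy_iterate {X : GrMod 𝒜} {d : ℤ} (h : X.SuppLE d) (n : ℕ) :
    (GrMod.cosyzygy^[n] X).SuppLE d := by
  induction n with
  | zero => exact h
  | succ n ih =>
    rw [Function.iterate_succ_apply']
    exact ih.cosyzygy hpos

end Truncation

/-! ### Vanishing of stable morphisms -/

/-- Every morphism `X → Y` factors through a projective graded module, that is, there are no nonzero
morphisms from `X` to `Y` in the stable category. -/
def StablyOrthogonal (X Y : GrMod 𝒜) : Prop :=
  ∀ f : X ⟶ Y, ∃ (P : GrMod 𝒜) (_ : Projective P) (a : X ⟶ P) (b : P ⟶ Y), f = a ≫ b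

section Stable

variable [GradedAlgebra 𝒜]

theorem StablyOrthogonal.subsingleton {X Y : GrMod 𝒜} (h : StablyOrthogonal X Y) :
    Subsingleton ((toStable 𝒜).obj X ⟶ (toStable 𝒜).obj Y) := by
  refine ⟨fun f g => ?_⟩
  obtain ⟨f, rfl⟩ := (toStable 𝒜).map_surjective f
  obtain ⟨g, rfl⟩ := (toStable 𝒜).map_surjective g
  exact (Quotient.functor_map_eq_iff _ _ _).2 (h (f - g))

variable [FiniteDimensional K A] (hself : Module.Injective Aᵐᵒᵖ A)
  {X' P X Y Q Z : GrMod 𝒜} {i : X' ⟶ P} {p : P ⟶ X} {j : Y ⟶ Q} {q : Q ⟶ Z}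

include hself

/-- A morphism `X' → Y` is stably zero iff it extends along a given embedding of `X'` into a
projective module. -/
theorem stablyOrthogonal_iff_extends (hP : Projective P) (hi : Function.Injective (Hom.lin i)) :
    StablyOrthogonal X' Y ↔ ∀ f : X' ⟶ Y, ∃ l : P ⟶ Y, i ≫ l = f := by
  refine ⟨fun h f => ?_, fun h f => ?_⟩
  · obtain ⟨R, hR, a, b, rfl⟩ := h f
    obtain ⟨a', rfl⟩ := exists_extension_of_projective hself hR i hi a
    exact ⟨a' ≫ b, (Category.assoc _ _ _).symm⟩
  · obtain ⟨l, hl⟩ := h f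
    exact ⟨P, hP, i, l, hl.symm⟩

omit hself [FiniteDimensional K A] [GradedAlgebra 𝒜] in
/-- A morphism `X → Z` is stably zero iff it lifts along a given epimorphism from a projective
module to `Z`. -/
theorem stablyOrthogonal_iff_lifts (hQ : Projective Q) [Epi q] :
    StablyOrthogonal X Z ↔ ∀ f : X ⟶ Z, ∃ l : X ⟶ Q, l ≫ q = f := by
  refine ⟨fun h f => ?_, fun h f => ?_⟩
  · obtain ⟨R, hR, a, b, rfl⟩ := h f
    exact ⟨a ≫ Projective.factorThru b q, by
      rw [Category.assoc, Projective.factorThru_comp]⟩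
  · obtain ⟨l, hl⟩ := h f
    exact ⟨Q, hQ, l, q, hl.symm⟩

/-- For short exact sequences `0 → X' → P → X → 0` and `0 → Y → Q → Z → 0` with `P` and `Q`
projective, the stable morphisms `X' → Y` vanish iff the stable morphisms `X → Z` do. -/
theorem stablyOrthogonal_shift_iff (h : IsShortExact i p) (hP : Projective P)
    (h' : IsShortExact j q) (hQ : Projective Q) :
    StablyOrthogonal X' Y ↔ StablyOrthogonal X Z := by
  have := h'.epi
  rw [stablyOrthogonal_iff_extends hself hP h.injective, stablyOrthogonal_iff_lifts (q := q) hQ]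
  refine ⟨fun hext f => ?_, fun hlift f => ?_⟩
  · exact exists_lift_of_extends h h' f (Projective.factorThru (p ≫ f) q)
      (Projective.factorThru_comp _ _) hext
  · obtain ⟨g, hg⟩ := exists_extension_of_projective hself hQ i h.injective (f ≫ j)
    exact exists_extension_of_lifts h h' f g hg hlift

omit hself in
theorem stablyOrthogonal_of_supp {a b : ℤ} (hX : X.SuppGE a) (hY : Y.SuppLE b) (hab : b < a) :
    StablyOrthogonal X Y := fun f =>
  ⟨_, projective_ind Y, 0, indπ Y, by rw [eq_zero_of_supp hX hY hab f, Limits.zero_comp]⟩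

omit hself in
theorem stablyOrthogonal_of_supp' {a b : ℤ} (hX : X.SuppLE a) (hY : Y.SuppGE b) (hab : a < b) :
    StablyOrthogonal X Y := fun f =>
  ⟨_, projective_ind Y, 0, indπ Y, by rw [eq_zero_of_supp' hX hY hab f, Limits.zero_comp]⟩

/-- If `T` lies in degrees `≤ 0` and has a syzygy `T'` in degrees `≥ 1`, then `T` has no stable
morphisms to its proper shifts. -/
theorem subsingleton_hom_shift (hpos : ∀ i < 0, 𝒜 i = ⊥) {T T' F : GrMod 𝒜} {s : T' ⟶ F}
    {t : F ⟶ T} (h : IsShortExact s t) (hF : Projective F) (hT : T.SuppLE 0) (hT' : T'.SuppGE 1)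
    (n : ℤ) (hn : n ≠ 0) :
    Subsingleton ((toStable 𝒜).obj T ⟶ shift ((toStable 𝒜).obj T) n) := by
  match n, hn with
  | Int.ofNat 0, hn => exact absurd rfl hn
  | Int.ofNat (m + 1), _ =>
    have h1 : StablyOrthogonal T (cosyzygy (cosyzygy^[m] T)) :=
      (stablyOrthogonal_shift_iff hself h hF (isShortExact_cosyzygy _)
        (projective_coind hself _)).1
        (stablyOrthogonal_of_supp hT' (hT.cosyzygy_iterate hpos m) zero_lt_one)
    rw [← Function.iterate_succ_apply' cosyzygy] at h1
    exact h1.subsingleton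
  | Int.negSucc m, _ =>
    have key : ∀ X : GrMod 𝒜, X.SuppLE 0 → StablyOrthogonal (cosyzygy X) (syzygy^[m] T) := by
      induction m with
      | zero =>
        exact fun X hX => (stablyOrthogonal_shift_iff hself (isShortExact_cosyzygy X)
          (projective_coind hself _) h hF).1 (stablyOrthogonal_of_supp' hX hT' zero_lt_one)
      | succ m ih =>
        intro X hX
        rw [Function.iterate_succ_apply']
        exact (stablyOrthogonal_shift_iff hself (isShortExact_cosyzygy _)
          (projective_coind hself _) (isShortExact_syzygy _) (projective_ind _)).2
          (ih (by simp) _ (hX.cosyzygy hpos))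
    have h1 : StablyOrthogonal T (syzygy (syzygy^[m] T)) :=
      (stablyOrthogonal_shift_iff hself (isShortExact_cosyzygy _)
        (projective_coind hself _) (isShortExact_syzygy _) (projective_ind _)).2 (key T hT)
    rw [← Function.iterate_succ_apply' syzygy] at h1
    exact h1.subsingleton

end Stable

/-! ### The tilting module -/

section Tilting

variable {n : ℕ} {X Y : Fin n → GrMod 𝒜}

/-- The direct sum of a finite family of morphisms. -/
def directSumMap (f : ∀ k, X k ⟶ Y k) : directSum X ⟶ directSum Y :=
  ofLin (X := directSum X) (Y := directSum Y)
    (LinearMap.pi fun k => Hom.lin (f k) ∘ₗ LinearMap.proj k)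
    fun _ _ hx k _ => lin_mem (f k) (hx k trivial)

/-- The inclusion of a summand. -/
def directSumι (X : Fin n → GrMod 𝒜) (k : Fin n) : X k ⟶ directSum X :=
  ofLin (Y := directSum X) (LinearMap.single Aᵐᵒᵖ (fun k => (X k).carrier) k) fun i x hx l _ => by
    change Pi.single (M := fun k => (X k).carrier) k x l ∈ (X l).deg i
    by_cases hl : l = k
    · subst hl
      rwa [Pi.single_eq_same]
    · rw [Pi.single_eq_of_ne hl]
      exact zero_mem _

/-- The projection to a summand. -/
def directSumProj (X : Fin n → GrMod 𝒜) (k : Fin n) : directSum X ⟶ X k :=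
  ofLin (X := directSum X) (LinearMap.proj k) fun _ _ hx => hx k trivial

theorem directSumι_proj_same (X : Fin n → GrMod 𝒜) (k : Fin n) :
    directSumι X k ≫ directSumProj X k = 𝟙 (X k) :=
  hom_ext fun x => Pi.single_eq_same (M := fun k => (X k).carrier) k x

/-- The morphism from a finite direct sum given by morphisms from the summands. -/
def directSumDesc {Y : GrMod 𝒜} (f : ∀ k, X k ⟶ Y) : directSum X ⟶ Y :=
  ofLin (X := directSum X) (∑ k, Hom.lin (f k) ∘ₗ LinearMap.proj k) fun i x hx => by
    rw [LinearMap.sum_apply]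
    exact sum_mem fun k _ => lin_mem (f k) (hx k trivial)

theorem lin_directSumDesc {Y : GrMod 𝒜} (f : ∀ k, X k ⟶ Y) (x : ∀ k, (X k).carrier) :
    Hom.lin (directSumDesc f) x = ∑ k, Hom.lin (f k) (x k) :=
  LinearMap.sum_apply _ _ _

/-- The short exact sequence that splits off the first summand. -/
theorem isShortExact_directSum (X : Fin (n + 1) → GrMod 𝒜) :
    IsShortExact (directSumι X 0) (ofLin (X := directSum X) (Y := directSum fun k => X k.succ)
      (LinearMap.pi fun k => LinearMap.proj k.succ) fun _ _ hx k _ => hx k.succ trivial) where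
  injective := Pi.single_injective (M := fun k => (X k).carrier) 0
  surjective y := ⟨(Fin.cons 0 y : ∀ k, (X k).carrier), rfl⟩
  exact y := by
    constructor
    · intro hy
      refine ⟨(y : ∀ k, (X k).carrier) 0, funext fun k => ?_⟩
      refine Fin.cases ?_ (fun k => ?_) k
      · exact Pi.single_eq_same (M := fun k => (X k).carrier) 0 _
      · exact (Pi.single_eq_of_ne (M := fun k => (X k).carrier) k.succ_ne_zero
          ((y : ∀ k, (X k).carrier) 0)).trans
          (congrFun hy k).symm
    · rintro ⟨x, rfl⟩
      exact funext fun k => Pi.single_eq_of_ne (M := fun k => (X k).carrier) k.succ_ne_zero x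

theorem directSumMap_surjective (f : ∀ k, X k ⟶ Y k)
    (hf : ∀ k, Function.Surjective (Hom.lin (f k))) :
    Function.Surjective (Hom.lin (directSumMap f)) := fun y => by
  choose x hx using fun k => hf k (y k)
  exact ⟨x, funext hx⟩

theorem SuppLE.directSum {d : ℤ} (h : ∀ k, (X k).SuppLE d) : (directSum X).SuppLE d := by
  refine fun j hj => eq_bot_iff.2 fun x hx => (Submodule.mem_bot K).2 (funext fun k => ?_)
  have hk : x k ∈ (X k).deg j := hx k trivial
  rw [h k j hj] at hk
  exact hk

theorem SuppGE.directSum {d : ℤ} (h : ∀ k, (X k).SuppGE d) : (directSum X).SuppGE d := by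
  refine fun j hj => eq_bot_iff.2 fun x hx => (Submodule.mem_bot K).2 (funext fun k => ?_)
  have hk : x k ∈ (X k).deg j := hx k trivial
  rw [h k j hj] at hk
  exact hk

variable (𝒜) in
/-- The tilting module has the syzygy `⨁ A(i)_{≥ 1}`, which lies in degrees `≥ 1`. -/
theorem exists_syzygy_tiltingSum [GradedAlgebra 𝒜] [FiniteDimensional K A]
    (hpos : ∀ i < 0, 𝒜 i = ⊥) (N : ℕ) :
    ∃ (T' F : GrMod 𝒜) (s : T' ⟶ F) (t : F ⟶ tiltingSum 𝒜 hpos N),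
      IsShortExact s t ∧ Projective F ∧ T'.SuppGE 1 := by
  let F : GrMod 𝒜 := directSum fun i : Fin N => gradeShift (i : ℤ) (regular 𝒜)
  let t : F ⟶ tiltingSum 𝒜 hpos N := directSumMap fun i => truncLEπ hpos 0 _
  refine ⟨ker t, F, kerι t, t,
    isShortExact_ker t (directSumMap_surjective _ fun i => truncLEπ_surjective hpos 0 _), ?_, ?_⟩
  · have := module_free_mulOpposite A
    have : Module.Projective Aᵐᵒᵖ F.carrier :=
      inferInstanceAs (Module.Projective Aᵐᵒᵖ (Fin N → A))
    exact projective_of_module F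
  · refine suppGE_ker_of_forall _ _ fun j hj x hx h => funext fun k => ?_
    exact ((truncLEπ_eq_zero_of_mem hpos (hx k trivial)).1 (congrFun h k)).resolve_right
      (by omega)

theorem suppLE_tiltingSum [GradedAlgebra 𝒜] (hpos : ∀ i < 0, 𝒜 i = ⊥) (N : ℕ) :
    (tiltingSum 𝒜 hpos N).SuppLE 0 :=
  SuppLE.directSum fun _ => suppLE_truncLE hpos 0 _

end Tilting

end GrMod

namespace GrMod

variable {K : Type w} [Field K] {A : Type v} [Ring A] [Algebra K A] {𝒜 : ℤ → Submodule K A}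

/-! ### Short exact sequences and thick subcategories -/

section Prod

variable (P Q : GrMod 𝒜)

/-- The inclusion of the first summand. -/
def prodInl : P ⟶ prod P Q :=
  ofLin (Y := prod P Q) (LinearMap.inl Aᵐᵒᵖ P.carrier Q.carrier) fun _ _ hx => ⟨hx, zero_mem _⟩

/-- The inclusion of the second summand. -/
def prodInr : Q ⟶ prod P Q :=
  ofLin (Y := prod P Q) (LinearMap.inr Aᵐᵒᵖ P.carrier Q.carrier) fun _ _ hx => ⟨zero_mem _, hx⟩

/-- The projection to the first summand. -/
def prodFst : prod P Q ⟶ P :=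
  ofLin (X := prod P Q) (LinearMap.fst Aᵐᵒᵖ P.carrier Q.carrier) fun _ _ hx => hx.1

/-- The projection to the second summand. -/
def prodSnd : prod P Q ⟶ Q :=
  ofLin (X := prod P Q) (LinearMap.snd Aᵐᵒᵖ P.carrier Q.carrier) fun _ _ hx => hx.2

theorem prodInr_snd : prodInr P Q ≫ prodSnd P Q = 𝟙 Q := rfl

theorem prodInl_snd : prodInl P Q ≫ prodSnd P Q = 0 := rfl

theorem prod_total : prodFst P Q ≫ prodInl P Q + prodSnd P Q ≫ prodInr P Q = 𝟙 (prod P Q) :=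
  hom_ext fun x => Prod.ext (add_zero (x : P.carrier × Q.carrier).1)
    (zero_add (x : P.carrier × Q.carrier).2)

end Prod

/-- A class of graded modules that contains the projective modules and is closed under direct
summands and under the third term of short exact sequences.  These are the classes of graded modules
that correspond to thick subcategories of the stable category. -/
structure IsThickClass (V : GrMod 𝒜 → Prop) : Prop where
  projective : ∀ P : GrMod 𝒜, Projective P → V P
  retract : ∀ {X Y : GrMod 𝒜} (i : X ⟶ Y) (r : Y ⟶ X), i ≫ r = 𝟙 X → V Y → V X
  third : ∀ {X Y Z : GrMod 𝒜} {f : X ⟶ Y} {g : Y ⟶ Z}, IsShortExact f g → V X → V Y → V Z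
  second : ∀ {X Y Z : GrMod 𝒜} {f : X ⟶ Y} {g : Y ⟶ Z}, IsShortExact f g → V X → V Z → V Y
  first : ∀ {X Y Z : GrMod 𝒜} {f : X ⟶ Y} {g : Y ⟶ Z}, IsShortExact f g → V Y → V Z → V X

theorem IsThickClass.of_eq_zero {V : GrMod 𝒜 → Prop} (hV : IsThickClass V) {X : GrMod 𝒜}
    (hX : ∀ x : X.carrier, x = 0) : V X :=
  hV.projective X ⟨fun _ _ _ => ⟨0, hom_ext fun x => by rw [hX x, map_zero, map_zero]⟩⟩

theorem IsThickClass.of_supp {V : GrMod 𝒜 → Prop} (hV : IsThickClass V) {X : GrMod 𝒜} {a b : ℤ}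
    (ha : X.SuppGE a) (hb : X.SuppLE b) (hab : b < a) : V X :=
  hV.of_eq_zero fun x => congrArg (fun f => Hom.lin f x) (eq_zero_of_supp ha hb hab (𝟙 X))

theorem IsThickClass.directSum {V : GrMod 𝒜 → Prop} (hV : IsThickClass V) {n : ℕ}
    {X : Fin n → GrMod 𝒜} (h : ∀ k, V (X k)) : V (directSum X) := by
  induction n with
  | zero => exact hV.of_eq_zero fun x => funext fun k => k.elim0
  | succ n ih =>
    exact hV.second (isShortExact_directSum X) (h 0) (ih fun k => h k.succ)

variable [GradedAlgebra 𝒜]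

theorem toStable_map_eq {X Y : GrMod 𝒜} {f g : X ⟶ Y} {P : GrMod 𝒜} (hP : Projective P)
    (a : X ⟶ P) (b : P ⟶ Y) (h : f - g = a ≫ b) : (toStable 𝒜).map f = (toStable 𝒜).map g :=
  (Quotient.functor_map_eq_iff _ _ _).2 ⟨P, hP, a, b, h⟩

variable [FiniteDimensional K A]

theorem cosyzygyMap_id (X : GrMod 𝒜) : cosyzygyMap (𝟙 X) = 𝟙 (cosyzygy X) :=
  hom_ext fun z => by
    obtain ⟨y, rfl⟩ := (isShortExact_cosyzygy X).surjective z
    rfl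

/-- The projection of `Hom_K(A, X) ⊕ Y` onto the cone of `f : X → Y`. -/
def coneπ {X Y : GrMod 𝒜} (f : X ⟶ Y) : prod (coind X) Y ⟶ cone f := cokerπ (coneRel f)

theorem isShortExact_cone {X Y : GrMod 𝒜} (f : X ⟶ Y) : IsShortExact (coneRel f) (coneπ f) :=
  isShortExact_coker _ fun _ _ hxy => coindι_injective X (congrArg Prod.fst hxy)

/-- A short exact sequence of graded modules gives a distinguished triangle of the stable category:
the cone of `X → Y` is the direct sum of `Z` and the projective module `Hom_K(A, X)`. -/
theorem exists_isDistinguished (hself : Module.Injective Aᵐᵒᵖ A) {X Y Z : GrMod 𝒜} {f : X ⟶ Y}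
    {g : Y ⟶ Z} (h : IsShortExact f g) :
    ∃ δ, IsDistinguished ((toStable 𝒜).map f) ((toStable 𝒜).map g) δ := by
  have hI := projective_coind hself X
  obtain ⟨e, he⟩ := exists_extension_of_projective hself hI f h.injective (coindι X)
  have hc := isShortExact_cone f
  have hfst : coneRel f ≫ prodFst _ _ = coindι X := rfl
  have hsnd : coneRel f ≫ prodSnd _ _ = -f := rfl
  have hrel : coindι X ≫ prodInl _ _ - f ≫ prodInr _ _ = coneRel f := by
    rw [← Category.comp_id (coneRel f), ← prod_total, Preadditive.comp_add, ← Category.assoc,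
      ← Category.assoc, hfst, hsnd, Preadditive.neg_comp, sub_eq_add_neg]
  obtain ⟨φ, hφ⟩ := hc.exists_desc (prodSnd _ _ ≫ g) (by
    rw [← Category.assoc, hsnd, Preadditive.neg_comp, h.comp_eq_zero, neg_zero])
  obtain ⟨ρ, hρ⟩ := hc.exists_desc (prodFst _ _ + prodSnd _ _ ≫ e) (by
    rw [Preadditive.comp_add, ← Category.assoc, hsnd, hfst, Preadditive.neg_comp, he,
      add_neg_cancel])
  obtain ⟨σ, hσ⟩ := h.exists_desc ((prodInr _ _ - e ≫ prodInl _ _) ≫ coneπ f) (by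
    rw [← Category.assoc, Preadditive.comp_sub, ← Category.assoc, he, ← neg_sub, hrel,
      Preadditive.neg_comp, hc.comp_eq_zero, neg_zero])
  have := h.epi
  have := hc.epi
  have hσφ : σ ≫ φ = 𝟙 Z := by
    rw [← cancel_epi g, ← Category.assoc, hσ, Category.assoc, hφ, Preadditive.sub_comp,
      Category.assoc, ← Category.assoc (prodInr _ _), prodInr_snd, ← Category.assoc (prodInl _ _),
      prodInl_snd, Limits.zero_comp, Limits.comp_zero, sub_zero, Category.id_comp, Category.comp_id]
  have hφσ : 𝟙 _ - φ ≫ σ = ρ ≫ prodInl _ _ ≫ coneπ f := by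
    have h1 : coneπ f ≫ φ ≫ σ = prodSnd _ _ ≫ prodInr _ _ ≫ coneπ f
        - prodSnd _ _ ≫ e ≫ prodInl _ _ ≫ coneπ f := by
      rw [← Category.assoc, hφ, Category.assoc, hσ, Preadditive.sub_comp, Preadditive.comp_sub,
        Category.assoc]
    have h2 : coneπ f ≫ ρ ≫ prodInl _ _ ≫ coneπ f = prodFst _ _ ≫ prodInl _ _ ≫ coneπ f
        + prodSnd _ _ ≫ e ≫ prodInl _ _ ≫ coneπ f := by
      rw [← Category.assoc, hρ, Preadditive.add_comp, Category.assoc]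
    have h3 : coneπ f = prodFst _ _ ≫ prodInl _ _ ≫ coneπ f
        + prodSnd _ _ ≫ prodInr _ _ ≫ coneπ f := by
      rw [← Category.assoc, ← Category.assoc, ← Preadditive.add_comp, prod_total, Category.id_comp]
    rw [← cancel_epi (coneπ f), Preadditive.comp_sub, Category.comp_id, h1, h2]
    nth_rewrite 1 [h3]
    abel
  let c : (toStable 𝒜).obj Z ⟶ (toStable 𝒜).obj (cone f) := (toStable 𝒜).map σ
  have hiso : IsIso c := ⟨(toStable 𝒜).map φ, by
    rw [← Functor.map_comp, hσφ, CategoryTheory.Functor.map_id], by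
    rw [← Functor.map_comp, ← CategoryTheory.Functor.map_id]
    exact (toStable_map_eq hI _ _ hφσ).symm⟩
  refine ⟨c ≫ (toStable 𝒜).map (coneδ f), X, Y, f, 𝟙 X, 𝟙 _, c, inferInstance, inferInstance, hiso,
    ?_, ?_, ?_⟩
  · exact (Category.comp_id _).trans (((toStable 𝒜).congr_map (Category.id_comp f)).symm.trans
      ((toStable 𝒜).map_comp (𝟙 X) f))
  · rw [Category.id_comp, ← Functor.map_comp]
    refine toStable_map_eq hI (-e) (prodInl _ _ ≫ coneπ f) ?_
    rw [hσ, Preadditive.sub_comp, Category.assoc, Preadditive.neg_comp]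
    exact sub_sub_cancel_left (prodInr _ _ ≫ coneπ f) _
  · have hm : (toStable 𝒜).map (cosyzygyMap (𝟙 X)) = 𝟙 _ := by
      rw [cosyzygyMap_id]
      exact (toStable 𝒜).map_id _
    exact (congrArg (fun t => (c ≫ (toStable 𝒜).map (coneδ f)) ≫ t) hm).trans (Category.comp_id _)

theorem IsThickIn.isThickClass (hself : Module.Injective Aᵐᵒᵖ A) {P : ObjectProperty (Stable 𝒜)}
    (hP : IsThickIn ⊤ P) {T : GrMod 𝒜} (hT : P ((toStable 𝒜).obj T)) :
    IsThickClass fun X => P ((toStable 𝒜).obj X) where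
  projective Q hQ := hP.summand (Y := (toStable 𝒜).obj T) trivial
    { i := (toStable 𝒜).map 0
      r := (toStable 𝒜).map 0
      retract := by
        rw [← Functor.map_comp, ← CategoryTheory.Functor.map_id]
        exact toStable_map_eq hQ (-𝟙 Q) (𝟙 Q) (by
          rw [Limits.comp_zero, zero_sub, Category.comp_id]) } hT
  retract i r h hY := hP.summand trivial
    { i := (toStable 𝒜).map i
      r := (toStable 𝒜).map r
      retract := by rw [← Functor.map_comp, h, CategoryTheory.Functor.map_id] } hY
  third h hX hY := hP.third _ _ _ (exists_isDistinguished hself h).choose_spec trivial hX hY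
  second h hX hZ := hP.second _ _ _ (exists_isDistinguished hself h).choose_spec trivial hX hZ
  first h hY hZ := hP.first _ _ _ (exists_isDistinguished hself h).choose_spec trivial hY hZ

/-- A thick subcategory of `thick T` is a thick subcategory of the stable category. -/
theorem thickIn_thick (T : Stable 𝒜) : thickIn (thick T) T = thick T := by
  have hT := isThickIn_thick T
  refine funext fun X => propext ⟨fun h => ?_, fun h P hP hPT => ?_⟩
  · refine h (thick T) ?_ fun _ _ hPT => hPT
    exact ⟨le_rfl, fun _ => hT.iso trivial, fun _ => hT.summand trivial, hT.shift,
      fun _ _ _ hd _ => hT.third _ _ _ hd trivial, fun _ _ _ hd _ => hT.second _ _ _ hd trivial,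
      fun _ _ _ hd _ => hT.first _ _ _ hd trivial⟩
  · refine h P ?_ hPT
    exact
      { le := fun _ _ => trivial
        iso := fun _ e hX => hP.iso (hT.iso trivial e (hP.le _ hX)) e hX
        summand := fun _ r hY => hP.summand (hT.summand trivial r (hP.le _ hY)) r hY
        shift := hP.shift
        third := fun f g k hd _ hX hY =>
          hP.third f g k hd (hT.third f g k hd trivial (hP.le _ hX) (hP.le _ hY)) hX hY
        second := fun f g k hd _ hX hZ =>
          hP.second f g k hd (hT.second f g k hd trivial (hP.le _ hX) (hP.le _ hZ)) hX hZ
        first := fun f g k hd _ hY hZ =>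
          hP.first f g k hd (hT.first f g k hd trivial (hP.le _ hY) (hP.le _ hZ)) hY hZ }

end GrMod

namespace GrMod

variable {K : Type w} [Field K] {A : Type v} [Ring A] [Algebra K A] {𝒜 : ℤ → Submodule K A}

/-! ### Modules concentrated in one degree -/

/-- The graded module `X` is concentrated in degree `d`. -/
def IsConcentrated (X : GrMod 𝒜) (d : ℤ) : Prop := X.SuppLE d ∧ X.SuppGE d

theorem IsConcentrated.mem_deg {X : GrMod 𝒜} {d : ℤ} (h : X.IsConcentrated d) (x : X.carrier) :
    x ∈ X.deg d := by
  refine X.deg_induction (p := fun x => x ∈ X.deg d) (zero_mem _) (fun _ _ => add_mem)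
    (fun i x hx => ?_) x
  rcases lt_trichotomy i d with hi | rfl | hi
  · rw [h.2 i hi, Submodule.mem_bot] at hx
    exact hx ▸ zero_mem _
  · exact hx
  · rw [h.1 i hi, Submodule.mem_bot] at hx
    exact hx ▸ zero_mem _

theorem IsConcentrated.of_surjective {X Y : GrMod 𝒜} {d : ℤ} (h : X.IsConcentrated d) (f : X ⟶ Y)
    (hf : Function.Surjective (Hom.lin f)) : Y.IsConcentrated d :=
  ⟨h.1.of_surjective f hf, h.2.of_surjective f hf⟩

theorem IsConcentrated.of_injective {X Y : GrMod 𝒜} {d : ℤ} (h : Y.IsConcentrated d) (f : X ⟶ Y)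
    (hf : Function.Injective (Hom.lin f)) : X.IsConcentrated d :=
  ⟨h.1.of_injective f hf, h.2.of_injective f hf⟩

theorem IsConcentrated.directSum {n : ℕ} {X : Fin n → GrMod 𝒜} {d : ℤ}
    (h : ∀ k, (X k).IsConcentrated d) : (directSum X).IsConcentrated d :=
  ⟨SuppLE.directSum fun k => (h k).1, SuppGE.directSum fun k => (h k).2⟩

variable [GradedAlgebra 𝒜]

variable (𝒜) in
/-- The inclusion of `A₀` into `A`, for the opposite rings. -/
def zeroInclusion : (𝒜 0)ᵐᵒᵖ →+* Aᵐᵒᵖ :=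
  RingHom.op
    { toFun := Subtype.val
      map_one' := rfl
      map_mul' := fun _ _ => rfl
      map_zero' := rfl
      map_add' := fun _ _ => rfl }

/-- A graded `A`-module, regarded as an ungraded `A₀`-module. -/
noncomputable def zeroModule (X : GrMod 𝒜) : ModuleCat.{v} (𝒜 0)ᵐᵒᵖ :=
  (ModuleCat.restrictScalars (zeroInclusion 𝒜)).obj (ModuleCat.of Aᵐᵒᵖ X.carrier)

/-- A morphism of graded modules, regarded as an `A₀`-linear map. -/
noncomputable def zeroModuleMap {X Y : GrMod 𝒜} (f : X ⟶ Y) : zeroModule X ⟶ zeroModule Y :=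
  (ModuleCat.restrictScalars (zeroInclusion 𝒜)).map (ModuleCat.ofHom (Hom.lin f))

theorem finite_zeroModule [FiniteDimensional K A] (X : GrMod 𝒜) :
    Module.Finite (𝒜 0)ᵐᵒᵖ (zeroModule X) := by
  have := finite_base X
  obtain ⟨s, hs⟩ := Module.Finite.fg_top (R := K) (M := X.carrier)
  let S : Submodule (𝒜 0)ᵐᵒᵖ (zeroModule X) := Submodule.span _ (s : Set X.carrier)
  have key : ∀ x ∈ Submodule.span K (s : Set X.carrier), (x : zeroModule X) ∈ S := by
    intro x hx
    induction hx using Submodule.span_induction with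
    | mem x h => exact Submodule.subset_span h
    | zero => exact S.zero_mem
    | add x y _ _ hx hy => exact S.add_mem hx hy
    | smul k x _ hx =>
      have h1 := S.smul_mem (MulOpposite.op
        (⟨algebraMap K A k, SetLike.algebraMap_mem_graded 𝒜 k⟩ : 𝒜 0)) hx
      have h2 : MulOpposite.op (algebraMap K A k) • x = k • x := algebraMap_smul Aᵐᵒᵖ k x
      rw [← h2]
      exact h1
  exact ⟨s, eq_top_iff.2 fun x _ => key x (hs ▸ Submodule.mem_top)⟩

/-- Morphisms between modules concentrated in one degree are the `A₀`-linear maps. -/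
theorem exists_hom_of_zeroModule {X Y : GrMod 𝒜} {d : ℤ} (hX : X.IsConcentrated d)
    (hY : Y.IsConcentrated d) (g : zeroModule X ⟶ zeroModule Y) :
    ∃ f : X ⟶ Y, ∀ x, Hom.lin f x = g.hom x := by
  let g₀ : X.carrier →+ Y.carrier := g.hom.toAddMonoidHom
  have hg₀ : ∀ (a : A) (x : X.carrier),
      g₀ (MulOpposite.op a • x) = MulOpposite.op a • g₀ x := by
    intro a x
    refine algebra_deg_induction (𝒜 := 𝒜) (p := fun a : A => g₀ (MulOpposite.op a • x)
      = MulOpposite.op a • g₀ x) ?_ ?_ ?_ a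
    · rw [MulOpposite.op_zero, zero_smul, zero_smul, map_zero]
    · intro a b ha hb
      rw [MulOpposite.op_add, add_smul, add_smul, map_add, ha, hb]
    · intro i a ha
      by_cases hi : i = 0
      · subst hi
        exact LinearMap.map_smul g.hom (MulOpposite.op (⟨a, ha⟩ : 𝒜 0)) x
      · have h1 : ∀ {Z : GrMod 𝒜} (_ : Z.IsConcentrated d) (z : Z.carrier),
            MulOpposite.op a • z = 0 := by
          intro Z hZ z
          rw [← Z.proj_same (hZ.mem_deg (MulOpposite.op a • z))]
          exact Z.proj_ne (Z.smul_mem ha (hZ.mem_deg z)) (by omega)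
        rw [h1 hX, h1 hY, map_zero]
  refine ⟨ofLin { g₀ with map_smul' := fun a x => hg₀ a.unop x } fun i x hx => ?_, fun _ => rfl⟩
  by_cases hi : i = d
  · subst hi
    exact hY.mem_deg _
  · have hx0 : x = 0 := by
      rw [← X.proj_same hx]
      exact X.proj_ne (hX.mem_deg x) (Ne.symm hi)
    rw [hx0, map_zero]
    exact zero_mem _

/-- A module in degree `d` that is projective over `A₀` is projective with respect to the modules in
degree `d`. -/
theorem exists_lift_of_projective_zeroModule {N Q Z : GrMod 𝒜} {d : ℤ} (hN : N.IsConcentrated d)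
    (hQ : Q.IsConcentrated d) (hproj : Projective (zeroModule N)) (q : Q ⟶ Z)
    (hq : Function.Surjective (Hom.lin q)) (f : N ⟶ Z) : ∃ l : N ⟶ Q, l ≫ q = f := by
  have : Epi (zeroModuleMap q) := (ModuleCat.epi_iff_surjective _).2 hq
  obtain ⟨l, hl⟩ := exists_hom_of_zeroModule hN hQ
    (Projective.factorThru (zeroModuleMap f) (zeroModuleMap q))
  refine ⟨l, hom_ext fun x => ?_⟩
  rw [lin_comp, LinearMap.comp_apply, hl]
  exact congrArg (fun m => m.hom x)
    (Projective.factorThru_comp (zeroModuleMap f) (zeroModuleMap q))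

theorem IsShortExact.zeroModule {X Y Z : GrMod 𝒜} {f : X ⟶ Y} {g : Y ⟶ Z}
    (h : IsShortExact f g) :
    (ShortComplex.mk (zeroModuleMap f) (zeroModuleMap g) (by
      ext x
      exact (h.exact _).2 ⟨x, rfl⟩)).ShortExact where
  exact := (ShortComplex.moduleCat_exact_iff _).2 fun y hy => (h.exact y).1 hy
  mono_f := (ModuleCat.mono_iff_injective _).2 h.injective
  epi_g := (ModuleCat.epi_iff_surjective _).2 h.surjective

section FreeModules

variable (hpos : ∀ i < 0, 𝒜 i = ⊥)

/-- The module `A₀`, placed in degree `d`, as the truncation `A(-d)_{≤ d}`. -/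
def baseModule (d : ℤ) : GrMod 𝒜 := truncLE hpos d (gradeShift (-d) (regular 𝒜))

theorem isConcentrated_baseModule (d : ℤ) : (baseModule hpos d).IsConcentrated d := by
  refine ⟨suppLE_truncLE hpos d _, ?_⟩
  have h : (gradeShift (-d) (regular 𝒜)).SuppGE d := fun j hj => hpos (j + -d) (by omega)
  exact h.of_surjective _ (truncLEπ_surjective hpos d _)

/-- A finite direct sum of copies of `A₀`, placed in degree `d`. -/
abbrev freeModule (d : ℤ) (k : ℕ) : GrMod 𝒜 := directSum fun _ : Fin k => baseModule hpos d

theorem isConcentrated_freeModule (d : ℤ) (k : ℕ) : (freeModule hpos d k).IsConcentrated d :=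
  IsConcentrated.directSum fun _ => isConcentrated_baseModule hpos d

theorem projective_zeroModule_freeModule (d : ℤ) (k : ℕ) :
    Projective (zeroModule (freeModule hpos d k)) := by
  let π := Hom.lin (truncLEπ hpos d (gradeShift (-d) (regular 𝒜)))
  have hdeg : ∀ a : A, a ∈ (gradeShift (-d) (regular 𝒜)).deg d ↔ a ∈ 𝒜 0 := by
    intro a
    change a ∈ 𝒜 (d + -d) ↔ _
    rw [add_neg_cancel]
  let e : (Fin k → 𝒜 0) →ₗ[(𝒜 0)ᵐᵒᵖ] zeroModule (freeModule hpos d k) :=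
    { toFun := fun v => (fun i => π (v i).1 : ∀ _ : Fin k, (baseModule hpos d).carrier)
      map_add' := fun v v' => funext fun i => map_add π (v i).1 (v' i).1
      map_smul' := fun a v => funext fun i => map_smul π (MulOpposite.op a.unop.1) (v i).1 }
  have he : Function.Bijective e := by
    refine ⟨(injective_iff_map_eq_zero e).2 fun v hv => funext fun i => Subtype.ext ?_, fun y => ?_⟩
    · exact ((truncLEπ_eq_zero_of_mem hpos ((hdeg _).2 (v i).2)).1 (congrFun hv i)).resolve_right
        (lt_irrefl _)
    · have : ∀ i, ∃ a : 𝒜 0, π a.1 = (y : ∀ _ : Fin k, (baseModule hpos d).carrier) i := by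
        intro i
        obtain ⟨a, ha, hai⟩ := (isConcentrated_baseModule hpos d).mem_deg
          ((y : ∀ _ : Fin k, (baseModule hpos d).carrier) i)
        exact ⟨⟨a, (hdeg a).1 ha⟩, hai⟩
      choose v hv using this
      exact ⟨v, funext hv⟩
  have := module_free_mulOpposite (𝒜 0)
  have : Module.Projective (𝒜 0)ᵐᵒᵖ (zeroModule (freeModule hpos d k)) :=
    Module.Projective.of_equiv (LinearEquiv.ofBijective e he)
  exact (IsProjective.iff_projective (R := (𝒜 0)ᵐᵒᵖ) (zeroModule (freeModule hpos d k))).1 this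

theorem exists_surjective_freeModule {N : GrMod 𝒜} {d : ℤ} (hN : N.IsConcentrated d) :
    ∃ (k : ℕ) (p : freeModule hpos d k ⟶ N), Function.Surjective (Hom.lin p) := by
  obtain ⟨k, s, hs⟩ := Submodule.fg_iff_exists_fin_generating_family.1
    (Module.Finite.fg_top (R := Aᵐᵒᵖ) (M := N.carrier))
  let m : ∀ i, gradeShift (-d) (regular 𝒜) ⟶ N := fun i =>
    ofLin (X := gradeShift (-d) (regular 𝒜))
      ({ toFun := fun a : A => MulOpposite.op a • s i
         map_add' := fun a b => add_smul (MulOpposite.op a) (MulOpposite.op b) (s i)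
         map_smul' := fun b a => mul_smul b (MulOpposite.op a) (s i) } :
        A →ₗ[Aᵐᵒᵖ] N.carrier) fun j a ha => by
          have := N.smul_mem (i := j + -d) (a := a) ha (hN.mem_deg (s i))
          rwa [show d + (j + -d) = j by ring] at this
  have hm : ∀ i, ∃ f : baseModule hpos d ⟶ N, truncLEπ hpos d _ ≫ f = m i :=
    fun i => exists_desc_truncLE hpos hN.1 (m i)
  choose f hf using hm
  refine ⟨k, directSumDesc f, fun x => ?_⟩
  obtain ⟨c, rfl⟩ := (Submodule.mem_span_range_iff_exists_fun Aᵐᵒᵖ).1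
    (hs ▸ Submodule.mem_top : x ∈ Submodule.span Aᵐᵒᵖ (Set.range s))
  refine ⟨fun i => Hom.lin (truncLEπ hpos d (gradeShift (-d) (regular 𝒜))) (c i).unop, ?_⟩
  refine (lin_directSumDesc f _).trans ?_
  exact Finset.sum_congr rfl fun i _ => congrArg (fun m => Hom.lin m (c i).unop) (hf i)

end FreeModules

variable [FiniteDimensional K A]

/-! ### Finite resolutions over `A₀` -/

section Resolutions

variable (hpos : ∀ i < 0, 𝒜 i = ⊥) {d : ℤ}

/-- One step of a free resolution over `A₀`. -/
theorem exists_isShortExact_freeModule {N : GrMod 𝒜} (hN : N.IsConcentrated d) :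
    ∃ (k : ℕ) (N' : GrMod 𝒜) (i : N' ⟶ freeModule hpos d k) (p : freeModule hpos d k ⟶ N),
      IsShortExact i p ∧ N'.IsConcentrated d ∧ ∀ n : ℕ,
        HasProjectiveDimensionLE (zeroModule N) (n + 1) →
          HasProjectiveDimensionLE (zeroModule N') n := by
  obtain ⟨k, p, hp⟩ := exists_surjective_freeModule hpos hN
  have h := isShortExact_ker p hp
  refine ⟨k, ker p, kerι p, p, h, (isConcentrated_freeModule hpos d k).of_injective _ h.injective,
    fun n hn => ?_⟩
  exact (h.zeroModule.hasProjectiveDimensionLT_X₃_iff n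
    (projective_zeroModule_freeModule hpos d k)).1 hn

/-- A thick class that contains `A₀` in degree `d` contains all modules in degree `d` that have
finite projective dimension over `A₀`. -/
theorem IsThickClass.of_hasProjectiveDimensionLE {V : GrMod 𝒜 → Prop} (hV : IsThickClass V)
    (hbase : V (baseModule hpos d)) (n : ℕ) : ∀ N : GrMod 𝒜, N.IsConcentrated d →
      HasProjectiveDimensionLE (zeroModule N) n → V N := by
  have hfree : ∀ k, V (freeModule hpos d k) := fun k => hV.directSum fun _ => hbase
  induction n with
  | zero =>
    intro N hN hpd
    obtain ⟨k, p, hp⟩ := exists_surjective_freeModule hpos hN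
    obtain ⟨l, hl⟩ := exists_lift_of_projective_zeroModule hN (isConcentrated_freeModule hpos d k)
      ((projective_iff_hasProjectiveDimensionLE_zero _).2 hpd) p hp (𝟙 N)
    exact hV.retract l p hl (hfree k)
  | succ n ih =>
    intro N hN hpd
    obtain ⟨k, N', i, p, h, hN', hpd'⟩ := exists_isShortExact_freeModule hpos hN
    exact hV.third h (ih N' hN' (hpd' n hpd)) (hfree k)

/-- The degree `d` part of `Hom_K(A, M)`, for a module `M` in degree `d`.  As an `A₀`-module it is
the injective module `Hom_K(A₀, M)`. -/
def injHull (d : ℤ) (M : GrMod 𝒜) : GrMod 𝒜 := truncGT hpos (d - 1) (coind M)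

/-- The inclusion of the degree `d` part into `Hom_K(A, M)`. -/
def injHullι (d : ℤ) (M : GrMod 𝒜) : injHull hpos d M ⟶ coind M :=
  kerι (truncLEπ hpos (d - 1) (coind M))

theorem isShortExact_injHull (d : ℤ) (M : GrMod 𝒜) :
    IsShortExact (injHullι hpos d M) (truncLEπ hpos (d - 1) (coind M)) :=
  isShortExact_trunc hpos (d - 1) (coind M)

theorem isConcentrated_injHull {M : GrMod 𝒜} (hM : M.IsConcentrated d) :
    (injHull hpos d M).IsConcentrated d := by
  have h := isShortExact_injHull hpos d M
  refine ⟨(hM.1.coind hpos).of_injective _ h.injective, ?_⟩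
  have := suppGE_truncGT hpos (d - 1) (coind M)
  rwa [sub_add_cancel] at this

/-- Morphisms from modules in degrees `≥ d` to `Hom_K(A, M)` have values in its part of degrees
`≥ d`. -/
theorem exists_lift_injHull {X M : GrMod 𝒜} (hX : X.SuppGE d) (f : X ⟶ coind M) :
    ∃ l : X ⟶ injHull hpos d M, l ≫ injHullι hpos d M = f :=
  (isShortExact_injHull hpos d M).exists_lift f
    (eq_zero_of_supp hX (suppLE_truncLE hpos (d - 1) _) (by omega) _)

theorem exists_isShortExact_injHull {M : GrMod 𝒜} (hM : M.IsConcentrated d) :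
    ∃ (C : GrMod 𝒜) (j : M ⟶ injHull hpos d M) (q : injHull hpos d M ⟶ C),
      IsShortExact j q ∧ C.IsConcentrated d := by
  obtain ⟨j, hj⟩ := exists_lift_injHull hpos hM.2 (coindι M)
  have hinj : Function.Injective (Hom.lin j) := by
    refine Function.Injective.of_comp (f := Hom.lin (injHullι hpos d M)) ?_
    rw [← LinearMap.coe_comp, ← lin_comp, hj]
    exact coindι_injective M
  have h := isShortExact_coker j hinj
  exact ⟨coker j, j, cokerπ j, h, (isConcentrated_injHull hpos hM).of_surjective _ h.surjective⟩

theorem exists_extension_injHull (hself : Module.Injective Aᵐᵒᵖ A) {X Y M : GrMod 𝒜}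
    (hY : Y.SuppGE d) (i : X ⟶ Y) (hi : Function.Injective (Hom.lin i))
    (f : X ⟶ injHull hpos d M) : ∃ l : Y ⟶ injHull hpos d M, i ≫ l = f := by
  have := (isShortExact_injHull hpos d M).mono
  obtain ⟨g, hg⟩ := exists_extension_of_projective hself (projective_coind hself M) i hi
    (f ≫ injHullι hpos d M)
  obtain ⟨l, hl⟩ := exists_lift_injHull hpos hY g
  refine ⟨l, ?_⟩
  rw [← cancel_mono (injHullι hpos d M), Category.assoc, hl, hg]

/-- Let `0 → M → I⁰ → I¹ → ⋯` be an injective coresolution over `A₀` with cosyzygies `C k`.  If `N`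
has projective dimension at most `k`, then `Ext¹(N, C k) = 0`, that is, every map from `N` to
`C (k + 1)` lifts to `Iᵏ`. -/
theorem exists_lift_of_hasProjectiveDimensionLE (hself : Module.Injective Aᵐᵒᵖ A)
    {C : ℕ → GrMod 𝒜} (hC : ∀ k, (C k).IsConcentrated d)
    {j : ∀ k, C k ⟶ injHull hpos d (C k)} {q : ∀ k, injHull hpos d (C k) ⟶ C (k + 1)}
    (h : ∀ k, IsShortExact (j k) (q k)) (k : ℕ) : ∀ N : GrMod 𝒜, N.IsConcentrated d →
      HasProjectiveDimensionLE (zeroModule N) k → ∀ f : N ⟶ C (k + 1), ∃ l, l ≫ q k = f := by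
  induction k with
  | zero =>
    intro N hN hpd f
    exact exists_lift_of_projective_zeroModule hN (isConcentrated_injHull hpos (hC 0))
      ((projective_iff_hasProjectiveDimensionLE_zero _).2 hpd) (q 0) (h 0).surjective f
  | succ k ih =>
    intro N hN hpd f
    obtain ⟨r, N', i, p, hip, hN', hpd'⟩ := exists_isShortExact_freeModule hpos hN
    have hF := isConcentrated_freeModule hpos d r
    obtain ⟨g, hg⟩ := exists_lift_of_projective_zeroModule hF
      (isConcentrated_injHull hpos (hC (k + 1))) (projective_zeroModule_freeModule hpos d r)
      (q (k + 1)) (h (k + 1)).surjective (p ≫ f)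
    refine exists_lift_of_extends hip (h (k + 1)) f g hg fun m => ?_
    obtain ⟨l, rfl⟩ := ih N' hN' (hpd' k hpd) m
    obtain ⟨l', rfl⟩ := exists_extension_injHull hpos hself hF.2 i hip.injective l
    exact ⟨l' ≫ q k, (Category.assoc _ _ _).symm⟩

/-- If `A₀` has finite global dimension, a thick class that contains the injective `A₀`-modules
`Hom_K(A₀, M)` in degree `d` contains all modules in degree `d`: a long enough cosyzygy is a direct
summand of an injective module. -/
theorem IsThickClass.of_injHull (hself : Module.Injective Aᵐᵒᵖ A)
    (hgl : HasFiniteGlobalDimension (𝒜 0)) {V : GrMod 𝒜 → Prop} (hV : IsThickClass V)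
    (hinj : ∀ M : GrMod 𝒜, M.IsConcentrated d → V (injHull hpos d M)) {M : GrMod 𝒜}
    (hM : M.IsConcentrated d) : V M := by
  obtain ⟨n, hn⟩ := hgl
  choose c j q hjq hc using fun X : {X : GrMod 𝒜 // X.IsConcentrated d} =>
    exists_isShortExact_injHull hpos X.2
  let C : ℕ → {X : GrMod 𝒜 // X.IsConcentrated d} :=
    fun k => Nat.rec ⟨M, hM⟩ (fun _ X => ⟨c X, hc X⟩) k
  have hS : ∀ k, IsShortExact (Z := (C (k + 1)).1) (j (C k)) (q (C k)) := fun k => hjq (C k)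
  obtain ⟨l, hl⟩ := exists_lift_of_hasProjectiveDimensionLE hpos hself (C := fun k => (C k).1)
    (fun k => (C k).2) hS n _ (C (n + 1)).2 (hn _ (finite_zeroModule _)) (𝟙 _)
  have hmain : ∀ k, V (C k).1 → V (C 0).1 := by
    intro k
    induction k with
    | zero => exact id
    | succ k ih => exact fun hk => ih (hV.first (hS k) (hinj _ (C k).2) hk)
  exact hmain (n + 1) (hV.retract l _ hl (hinj _ (C n).2))

end Resolutions

/-! ### Generation -/

section Generation

variable (hpos : ∀ i < 0, 𝒜 i = ⊥)

/-- A thick class that contains the tilting module contains all modules `A(m)_{≤ 0}` with `m ≥ 0`. -/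
theorem IsThickClass.truncLE_gradeShift {V : GrMod 𝒜 → Prop} (hV : IsThickClass V) {N : ℕ}
    (hN : ∀ k : ℤ, (N : ℤ) < k → 𝒜 k = ⊥) (hT : V (tiltingSum 𝒜 hpos N)) (m : ℕ) :
    V (truncLE hpos 0 (gradeShift (m : ℤ) (regular 𝒜))) := by
  rcases lt_or_ge m N with hm | hm
  · let X : Fin N → GrMod 𝒜 := fun i => truncLE hpos 0 (gradeShift (i : ℤ) (regular 𝒜))
    exact hV.retract (directSumι X ⟨m, hm⟩) (directSumProj X ⟨m, hm⟩) (directSumι_proj_same X _) hT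
  · have hsupp : (gradeShift (m : ℤ) (regular 𝒜)).SuppLE 0 := fun j hj => hN (j + m) (by omega)
    obtain ⟨g, hg⟩ := exists_desc_truncLE hpos hsupp (𝟙 _)
    have := epi_of_surjective _ (truncLEπ_surjective hpos 0 (gradeShift (m : ℤ) (regular 𝒜)))
    refine hV.retract g (truncLEπ hpos 0 _) ?_ (hV.projective _ (projective_regular_gradeShift _))
    rw [← cancel_epi (truncLEπ hpos 0 _), ← Category.assoc, hg, Category.id_comp, Category.comp_id]

/-- If `A₀` has finite global dimension, a thick class that contains the tilting module contains all
modules in degrees `≤ 0`: the lowest degree component of `A(m)_{≤ 0}` is `A₀`, in degree `-m`. -/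
theorem IsThickClass.of_suppLE_zero (hgl : HasFiniteGlobalDimension (𝒜 0)) {V : GrMod 𝒜 → Prop}
    (hV : IsThickClass V) {N : ℕ} (hN : ∀ k : ℤ, (N : ℤ) < k → 𝒜 k = ⊥)
    (hT : V (tiltingSum 𝒜 hpos N)) (m : ℕ) :
    ∀ X : GrMod 𝒜, X.SuppGE (1 - m) → X.SuppLE 0 → V X := by
  obtain ⟨n, hn⟩ := hgl
  induction m with
  | zero => exact fun X h1 h2 => hV.of_supp h1 h2 (by simp)
  | succ m ih =>
    let Y := truncLE hpos 0 (gradeShift (m : ℤ) (regular 𝒜))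
    obtain ⟨g, hg⟩ := exists_desc_truncLE hpos ((suppLE_truncLE hpos (-(m : ℤ))
      (gradeShift (m : ℤ) (regular 𝒜))).mono (b := 0) (by omega)) (truncLEπ hpos (-(m : ℤ)) _)
    have hgs : Function.Surjective (Hom.lin g) := fun z => by
      obtain ⟨a, rfl⟩ := truncLEπ_surjective hpos (-(m : ℤ)) _ z
      exact ⟨_, congrArg (fun f => Hom.lin f a) hg⟩
    have hbase : V (baseModule hpos (-(m : ℤ))) := by
      rw [baseModule, neg_neg]
      refine hV.third (isShortExact_ker g hgs) (ih _ ?_ ?_)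
        (hV.truncLE_gradeShift hpos hN hT m)
      · refine suppGE_ker_of_forall g _ fun j hj y hy hy0 => ?_
        obtain ⟨a, ha, rfl⟩ := hy
        have h1 : Hom.lin (truncLEπ hpos (-(m : ℤ)) _) a = 0 :=
          (congrArg (fun f => Hom.lin f a) hg).symm.trans hy0
        rw [((truncLEπ_eq_zero_of_mem hpos ha).1 h1).resolve_right (by omega)]
        exact map_zero _
      · exact (suppLE_truncLE hpos 0 _).of_injective _ (isShortExact_ker g hgs).injective
    intro X h1 h2
    have hX := isShortExact_trunc hpos (-(m : ℤ)) X
    have h3 := suppGE_truncGT hpos (-(m : ℤ)) X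
    refine hV.second hX (ih _ ?_ (h2.of_injective _ hX.injective))
      (hV.of_hasProjectiveDimensionLE hpos hbase n _ ⟨suppLE_truncLE hpos _ X, ?_⟩
        (hn _ (finite_zeroModule _)))
    · rwa [neg_add_eq_sub] at h3
    · have h4 := h1.of_surjective _ hX.surjective
      rwa [show (1 : ℤ) - ((m + 1 : ℕ) : ℤ) = -m by push_cast; ring] at h4

/-- If `A₀` has finite global dimension, a thick class that contains the tilting module contains all
graded modules.  For the modules in degree `d > 0` one uses that `Hom_K(A₀, M)` is the part of
highest degree of the projective module `Hom_K(A, M)`. -/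
theorem IsThickClass.eq_all (hself : Module.Injective Aᵐᵒᵖ A)
    (hgl : HasFiniteGlobalDimension (𝒜 0)) {V : GrMod 𝒜 → Prop} (hV : IsThickClass V) {N : ℕ}
    (hN : ∀ k : ℤ, (N : ℤ) < k → 𝒜 k = ⊥) (hT : V (tiltingSum 𝒜 hpos N)) (X : GrMod 𝒜) : V X := by
  obtain ⟨d, hd⟩ := exists_suppLE X
  induction d generalizing X with
  | zero =>
    obtain ⟨m, hm⟩ := exists_suppGE X
    refine hV.of_suppLE_zero hpos hgl hN hT (m + 1) X ?_ hd
    rwa [show (1 : ℤ) - ((m + 1 : ℕ) : ℤ) = -m by push_cast; ring]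
  | succ d ih =>
    have hX := isShortExact_trunc hpos d X
    refine hV.second hX ?_ (ih _ (suppLE_truncLE hpos d X))
    refine hV.of_injHull hpos (d := ((d + 1 : ℕ) : ℤ)) hself hgl (fun M hM => ?_)
      ⟨hd.of_injective _ hX.injective, suppGE_truncGT hpos d X⟩
    refine hV.first (isShortExact_injHull hpos _ M)
      (hV.projective _ (projective_coind hself M)) (ih _ ?_)
    have := suppLE_truncLE hpos (((d + 1 : ℕ) : ℤ) - 1) (coind M)
    rwa [show ((d + 1 : ℕ) : ℤ) - 1 = d by push_cast; ring] at this ⊢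

end Generation

end GrMod

theorem mainTheorem4 {K : Type w} [Field K] [IsAlgClosed K] {A : Type v} [Ring A] [Algebra K A]
    [FiniteDimensional K A] (𝒜 : ℤ → Submodule K A) [GradedAlgebra 𝒜]
    (hpos : ∀ i < 0, 𝒜 i = ⊥) (hself : Module.Injective Aᵐᵒᵖ A)
    (N : ℕ) (hN : ∀ k : ℤ, (N : ℤ) < k → 𝒜 k = ⊥) :
    GrMod.IsTiltingIn (GrMod.thick ((GrMod.toStable 𝒜).obj (GrMod.tiltingSum 𝒜 hpos N)))
        ((GrMod.toStable 𝒜).obj (GrMod.tiltingSum 𝒜 hpos N)) ∧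
      (HasFiniteGlobalDimension (𝒜 0) →
        GrMod.IsTiltingIn ⊤ ((GrMod.toStable 𝒜).obj (GrMod.tiltingSum 𝒜 hpos N))) := by
  obtain ⟨T', F, s, t, hst, hF, hT'⟩ := GrMod.exists_syzygy_tiltingSum 𝒜 hpos N
  have hhom := GrMod.subsingleton_hom_shift hself hpos hst hF (GrMod.suppLE_tiltingSum hpos N) hT'
  refine ⟨⟨fun _ _ hT => hT, hhom, GrMod.thickIn_thick _⟩, fun hgl => ⟨trivial, hhom, ?_⟩⟩
  refine funext fun X => propext ⟨fun _ => trivial, fun _ P hP hPT => ?_⟩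
  exact (hP.isThickClass hself hPT).eq_all hpos hself hgl hN hPT X.as
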